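/- **Setting.** For $n\ge 0$ let $\mathbb M$ be the $2^n\times 2^n$ complex matrices, $H\in\mathbb M$ Hermitian, $\beta\in\mathbb R$, $\rho_\beta=e^{-\beta H}/\operatorname{tr}e^{-\beta H}$, $s\in[0,1]$, and $\langle A,B\rangle_s=\operatorname{tr}(A^\dagger\rho_\beta^{1-s}B\rho_\beta^{s})$. A quantum channel $\mathcal N$ (with Hilbert–Schmidt dual $\mathcal N^\dagger$) is called a *Gibbs sampler* if it satisfies $s$-detailed balance, $\langle A,\mathcal N^\dagger(B)\rangle_s=\langle\mathcal N^\dagger(A),B\rangle_s$ for all $A,B$, has $\rho_\beta$ as its unique fixed state, and has its spectrum in $[0,1]$. Let $gap(\mathcal N)$ be $1$ minus its largest eigenvalue other than $1$, let $t_{mix}(\eta)$ be the least $t\in\mathbb N$ such that $\|\mathcal N^t(\rho)-\rho_\beta\|_1\le\eta$ for all states $\rho$, and let $\mathbb V_{\rho_\beta}[O]=\operatorname{tr}(O^2\rho_\beta)-(\operatorname{tr}(O\rho_\beta))^2$. A *measurement* $\mathcal M$ with $m$ ancilla qubits is a circuit that starts with the ancillas in $|0\rangle$, applies a list of operations, each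 of them either a unitary on the ancillas alone or a controlled Hamiltonian evolution $\sum_{\ell=0}^{2^m-1}e^{-i\theta(\ell-2^{m}/2)O}\otimes|\ell\rangle\langle\ell|$ (which costs evolution time $|\theta|\,2^m/2$), measures the ancillas in the computational basis, and reports a fixed real function of the result. A *single-trajectory protocol* applies $\mathcal N$ to the initial state $T_{burn}$ times, then performs $K$ rounds, each consisting of $\mathcal M$ (with outcome $e_t$ recorded), $r$ applications of $\mathcal N$, and $\mathcal M$ again (with outcome discarded), and outputs $\frac1K\sum_{t=1}^K e_t$. It uses $t_{\mathcal N}=T_{burn}+Kr$ applications of $\mathcal N$, and its controlled evolution time $t_{\mathcal M}$ of $O$ is $2K$ times that of one run of $\mathcal M$. **Corollary 6.4 (Thermal expectation estimation for commuting observables).** There are absolute constants $C>0$ and $a\in\mathbb N$ such that for all $\kappa\ge2$, $0<\epsilon\le\frac12$, $\eta>0$, $V\ge0$, $\Delta>0$, $T\in\mathbb N$ there are two single-trajectory protocols, which depend on these numbers only, with the following property. For every $n$, $H$, $\beta$, $s$, every Gibbs sampler $\mathcal N$ with $t_{mix}(\eta)\le T$ and $gap(\mathcal N)\ge\Delta$,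 every Hermitian $O$ that commutes with $H$ and satisfies $\|O\|\le\kappa$ and $\mathbb V_{\rho_\beta}[O]\le V$, and every initial state, the output of either protocol differs from $\operatorname{tr}(O\rho_\beta)$ by less than $\epsilon$ with probability at least $1-2\eta$. The costs are as follows. 1. The first protocol measures after every application of $\mathcal N$ ($r=1$), and $$m\le C\left(\log\kappa+\log\log\epsilon^{-1}\right),\qquad t_{\mathcal N}\le T+C\,\frac{V+1}{\epsilon^2\eta\,\Delta},\qquad t_{\mathcal M}\le C\,\frac{V+1}{\epsilon^2\eta\,\Delta}\left((\log\epsilon^{-1})^a+(\log\kappa)^a\right).$$ 2. The second protocol uses the same measurement $\mathcal M$ but skips measurements, taking $r=\lceil1/\Delta\rceil$, and $$t_{\mathcal N}\le T+C\,\frac{V+1}{\epsilon^2\eta\,\Delta},\qquad t_{\mathcal M}\le C\,\frac{V+1}{\epsilon^2\eta}\left((\log\epsilon^{-1})^a+(\log\kappa)^a\right).$$ -/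

import Mathlib

open scoped Kronecker ComplexOrder

noncomputable section

namespace ThermalEst

/-- Operators on a `d`-dimensional Hilbert space. -/
abbrev Op (d : ℕ) := Matrix (Fin d) (Fin d) ℂ

/-! ### States, Gibbs states, norms -/

/-- Density matrices. -/
def IsState {d : ℕ} (ρ : Op d) : Prop := ρ.PosSemidef ∧ ρ.trace = 1

/-- The Gibbs state `exp (-β H) / tr (exp (-β H))`. -/
def gibbs {d : ℕ} (H : Op d) (β : ℝ) : Op d :=
  (NormedSpace.exp ((-(β : ℂ)) • H)).trace⁻¹ • NormedSpace.exp ((-(β : ℂ)) • H)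

/-- Real power `ρ ^ s` of a Hermitian matrix, by functional calculus. -/
def rpow {d : ℕ} (ρ : Op d) (s : ℝ) : Op d := cfc (fun x : ℝ => x ^ s) ρ

/-- Operator norm, with respect to the Euclidean norm. -/
def opNorm {d : ℕ} (A : Op d) : ℝ := ‖Matrix.toEuclideanCLM (𝕜 := ℂ) A‖

/-- Trace norm: the sum of the singular values. -/
def traceNorm {d : ℕ} (A : Op d) : ℝ :=
  ∑ i, Real.sqrt ((Matrix.isHermitian_conjTranspose_mul_self A).eigenvalues i)

/-- The expectation `tr (O ρ)`. -/
def expect {d : ℕ} (ρ O : Op d) : ℝ := (O * ρ).trace.re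

/-- The variance `tr (O² ρ) - (tr (O ρ))²`. -/
def variance {d : ℕ} (ρ O : Op d) : ℝ := expect ρ (O * O) - expect ρ O ^ 2

/-! ### Channels, detailed balance, spectral gap, mixing time -/

/-- Linear maps on operators. -/
abbrev SuperOp (d : ℕ) := Module.End ℂ (Op d)

/-- Quantum channels (completely positive and trace preserving maps), in Kraus form. -/
def IsChannel {d : ℕ} (T : SuperOp d) : Prop :=
  ∃ (k : ℕ) (K : Fin k → Op d),
    (∀ X, T X = ∑ u, K u * X * (K u).conjTranspose) ∧ ∑ u, (K u).conjTranspose * K u = 1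

/-- The dual (Heisenberg picture) of `T` for the Hilbert-Schmidt inner product
`tr (A† B)`; see `trace_conjTranspose_mul_dual` for the defining property. -/
def dual {d : ℕ} (T : SuperOp d) (B : Op d) : Op d :=
  Matrix.of fun i j => ((T (Matrix.single i j 1)).conjTranspose * B).trace

theorem trace_conjTranspose_mul_dual {d : ℕ} (T : SuperOp d) (A B : Op d) :
    (A.conjTranspose * dual T B).trace = ((T A).conjTranspose * B).trace := by
  have h : T A = ∑ i, ∑ j, A i j • T (Matrix.single i j 1) := by
    conv_lhs => rw [Matrix.matrix_eq_sum_single A]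
    simp only [map_sum]
    refine Finset.sum_congr rfl fun i _ => Finset.sum_congr rfl fun j _ => ?_
    rw [← map_smul, Matrix.smul_single, smul_eq_mul, mul_one]
  rw [h]
  simp only [Matrix.conjTranspose_sum, Matrix.conjTranspose_smul, Matrix.sum_mul,
    Matrix.trace_sum, Matrix.smul_mul, Matrix.trace_smul, smul_eq_mul]
  rw [Finset.sum_comm]
  simp only [Matrix.trace, Matrix.diag_apply, Matrix.mul_apply, Matrix.conjTranspose_apply, dual,
    Matrix.of_apply]

/-- The weighted inner product `⟨M, N⟩_s = tr (M† ρ^(1-s) N ρ^s)`. -/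
def weighted {d : ℕ} (ρ : Op d) (s : ℝ) (M N : Op d) : ℂ :=
  (M.conjTranspose * rpow ρ (1 - s) * N * rpow ρ s).trace

/-- `s`-detailed balance with respect to `ρ`. -/
def DetailedBalance {d : ℕ} (ρ : Op d) (s : ℝ) (T : SuperOp d) : Prop :=
  ∀ A B : Op d, weighted ρ s A (dual T B) = weighted ρ s (dual T A) B

/-- `N` is a channel that satisfies `s`-detailed balance with respect to `ρ`, has `ρ` as its unique
fixed state, and has its spectrum in `[0, 1]`. -/
structure IsGibbsSampler {d : ℕ} (ρ : Op d) (s : ℝ) (N : SuperOp d) : Prop where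
  channel : IsChannel N
  balance : DetailedBalance ρ s N
  fixed : N ρ = ρ
  unique : ∀ σ : Op d, IsState σ → N σ = σ → σ = ρ
  spectrum_subset : spectrum ℂ N ⊆ (fun x : ℝ => (x : ℂ)) '' Set.Icc 0 1

/-- The spectral gap: the distance from the eigenvalue `1` to the largest other eigenvalue (for maps
with real spectrum and simple largest eigenvalue `1`). -/
def gap {d : ℕ} (N : SuperOp d) : ℝ :=
  1 - sSup {x : ℝ | x ≠ 1 ∧ Module.End.HasEigenvalue N (x : ℂ)}

/-- The mixing time: the least number of applications of `N` that brings every initial state within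
trace norm distance `η` of `ρ`. -/
def mixingTime {d : ℕ} (ρ : Op d) (N : SuperOp d) (η : ℝ) : ℕ :=
  sInf {t : ℕ | ∀ σ : Op d, IsState σ → traceNorm ((N ^ t) σ - ρ) ≤ η}

/-! ### Measurement circuits -/

/-- Operations on a system together with `m` ancilla qubits. -/
inductive Gate (m : ℕ) where
  /-- A unitary on the ancilla register only. -/
  | ancilla (U : Matrix.unitaryGroup (Fin (2 ^ m)) ℂ)
  /-- Controlled Hamiltonian evolution of the observable: with the ancilla register in the basis
  state `ℓ`, the system evolves under `O` for the time `θ * (ℓ - 2 ^ m / 2)`. -/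
  | evolve (θ : ℝ)

/-- The matrix of a gate when the observable is `O`; system first, ancilla second. For `evolve θ` it
is `∑ ℓ, exp (-i θ (ℓ - 2 ^ m / 2) O) ⊗ |ℓ⟩⟨ℓ|`. -/
def Gate.toMatrix {m d : ℕ} (O : Op d) :
    Gate m → Matrix (Fin d × Fin (2 ^ m)) (Fin d × Fin (2 ^ m)) ℂ
  | .ancilla U => (1 : Op d) ⊗ₖ (U : Matrix (Fin (2 ^ m)) (Fin (2 ^ m)) ℂ)
  | .evolve θ => Matrix.blockDiagonal fun ℓ : Fin (2 ^ m) =>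
      NormedSpace.exp
        ((-Complex.I * ((θ * (((ℓ : ℕ) : ℝ) - 2 ^ m / 2) : ℝ) : ℂ)) • O)

/-- The controlled evolution time of a gate: the maximum of `|θ * (ℓ - 2 ^ m / 2)|` over `ℓ`. -/
def Gate.time {m : ℕ} : Gate m → ℝ
  | .ancilla _ => 0
  | .evolve θ => |θ| * (2 ^ m / 2)

/-- A measurement: ancillas are prepared in the zero state, the gates are applied from left to
right, the ancillas are measured in the computational basis with result `j`, and the real number
`readout j` is reported. Nothing here refers to the observable or to the system; the observable
enters only through the `evolve` gates. -/
structure Measurement where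
  ancillas : ℕ
  gates : List (Gate ancillas)
  readout : Fin (2 ^ ancillas) → ℝ

namespace Measurement

/-- The unitary of the whole circuit. -/
def unitary (M : Measurement) {d : ℕ} (O : Op d) :
    Matrix (Fin d × Fin (2 ^ M.ancillas)) (Fin d × Fin (2 ^ M.ancillas)) ℂ :=
  M.gates.foldl (fun A g => g.toMatrix O * A) 1

/-- The Kraus operator `(I ⊗ ⟨j|) U (I ⊗ |0⟩)` on the system that goes with the result `j`. -/
def kraus (M : Measurement) {d : ℕ} (O : Op d) (j : Fin (2 ^ M.ancillas)) : Op d :=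
  Matrix.of fun a b => M.unitary O (a, j) (b, ⟨0, by positivity⟩)

/-- The (unnormalized) system state after the result `j`. -/
def branch (M : Measurement) {d : ℕ} (O : Op d) (j : Fin (2 ^ M.ancillas)) (X : Op d) : Op d :=
  M.kraus O j * X * (M.kraus O j).conjTranspose

/-- The measurement channel, with the result forgotten. -/
def channel (M : Measurement) {d : ℕ} (O : Op d) (X : Op d) : Op d := ∑ j, M.branch O j X

/-- The controlled evolution time used by one run of the measurement. -/
def time (M : Measurement) : ℝ := (M.gates.map Gate.time).sum

end Measurement

/-! ### Single-trajectory estimation -/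

/-- A single-trajectory estimation protocol: apply the sampler `burnIn` times, then perform `rounds`
rounds, each of which consists of a measurement (whose result is recorded), `spacing` applications of
the sampler, and a second measurement (whose result is discarded). -/
structure Protocol where
  meas : Measurement
  burnIn : ℕ
  rounds : ℕ
  spacing : ℕ

namespace Protocol

/-- The number of ancilla qubits. -/
def ancillas (P : Protocol) : ℕ := P.meas.ancillas

/-- The total number of applications of the sampler. -/
def samplerTime (P : Protocol) : ℕ := P.burnIn + P.rounds * P.spacing

/-- The total controlled evolution time of the observable, two measurements per round. -/
def evolutionTime (P : Protocol) : ℝ := 2 * P.rounds * P.meas.time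

/-- One round in which the recorded result is `j`. -/
def round (P : Protocol) {d : ℕ} (O : Op d) (N : SuperOp d) (j : Fin (2 ^ P.meas.ancillas))
    (X : Op d) : Op d :=
  P.meas.channel O ((N ^ P.spacing) (P.meas.branch O j X))

/-- The rounds with a given list of recorded results. -/
def run (P : Protocol) {d : ℕ} (O : Op d) (N : SuperOp d) :
    List (Fin (2 ^ P.meas.ancillas)) → Op d → Op d
  | [], X => X
  | j :: js, X => run P O N js (round P O N j X)

/-- The probability of the sequence `e` of recorded results, from the initial state `σ`. -/
def prob (P : Protocol) {d : ℕ} (O : Op d) (N : SuperOp d) (σ : Op d)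
    (e : Fin P.rounds → Fin (2 ^ P.meas.ancillas)) : ℝ :=
  (P.run O N (List.ofFn e) ((N ^ P.burnIn) σ)).trace.re

/-- The output: the empirical average of the recorded outcomes. -/
def output (P : Protocol) (e : Fin P.rounds → Fin (2 ^ P.meas.ancillas)) : ℝ :=
  (∑ t, P.meas.readout (e t)) / P.rounds

open Classical in
/-- The probability that the output is within `ε` of `v`. -/
def successProb (P : Protocol) {d : ℕ} (O : Op d) (N : SuperOp d) (σ : Op d) (v ε : ℝ) : ℝ :=
  ∑ e with |P.output e - v| < ε, P.prob O N σ e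

end Protocol

/-- `P` estimates `tr (O ρ_β)` to precision `ε` with probability at least `1 - 2 η`, from every initial
state, for all systems of `n` qubits, all Hamiltonians `H`, all Gibbs samplers `N` with mixing time at
most `T` and gap at least `Δ`, and all observables `O` that commute with `H`, have norm at most `κ`
and thermal variance at most `V`. -/
def Estimates (P : Protocol) (κ ε η V Δ : ℝ) (T : ℕ) : Prop :=
  ∀ (n : ℕ) (H O : Op (2 ^ n)) (β s : ℝ) (N : SuperOp (2 ^ n)),
    H.IsHermitian → O.IsHermitian → Commute O H → opNorm O ≤ κ →
    0 ≤ s → s ≤ 1 → IsGibbsSampler (gibbs H β) s N →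
    variance (gibbs H β) O ≤ V → Δ ≤ gap N → mixingTime (gibbs H β) N η ≤ T →
    ∀ σ : Op (2 ^ n), IsState σ →
      1 - 2 * η ≤ P.successProb O N σ (expect (gibbs H β) O) ε

end ThermalEst

end

/-!
The measurement prepares the ancillas in a triangular window, lets them interact once with the
observable and measures the Hermitian matrix that approximates, through a sine polynomial in the
translations of the register, the generator of these translations. On an eigenvector of the
observable the mean of the result is the eigenvalue up to `ε / 2`, and the mean square error is
bounded by a constant; this takes a register of polynomial size in `κ` and `log ε⁻¹`.

Since the observable commutes with the Gibbs state, the measurement channel fixes that state, and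
its adjoint is a contraction for the weighted inner product in which the sampler is self-adjoint. In
the stationary trajectory the correlation of two outcomes therefore decays geometrically in the
number of rounds between them, and Chebyshev's inequality controls the empirical average. The
burn-in replaces the stationary state by an arbitrary initial state at the cost of `η`.
-/

open scoped Kronecker ComplexOrder

noncomputable section

namespace ThermalEst

/-! ### Powers of faithful states and Gibbs states -/

theorem pos_of_mem_spectrum {n : Type*} [Fintype n] [DecidableEq n] {A : Matrix n n ℂ}
    (hA : A.PosDef) {x : ℝ} (hx : x ∈ spectrum ℝ A) : 0 < x := by
  rw [hA.isHermitian.spectrum_real_eq_range_eigenvalues] at hx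
  obtain ⟨i, rfl⟩ := hx
  exact hA.eigenvalues_pos i

section Powers

variable {d : ℕ} {ρ : Op d}

theorem rpow_isHermitian (ρ : Op d) (s : ℝ) : (rpow ρ s).IsHermitian :=
  cfc_predicate (fun x : ℝ => x ^ s) ρ

theorem commute_rpow (hρ : ρ.IsHermitian) {X : Op d} (h : Commute ρ X) (s : ℝ) :
    Commute (rpow ρ s) X :=
  IsSelfAdjoint.commute_cfc (show IsSelfAdjoint ρ from hρ) h _

theorem rpow_mul_rpow (hρ : ρ.PosDef) (s t : ℝ) : rpow ρ s * rpow ρ t = rpow ρ (s + t) := by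
  have hcont (f : ℝ → ℝ) : ContinuousOn f (spectrum ℝ ρ) :=
    (Matrix.finite_real_spectrum (A := ρ)).continuousOn f
  unfold rpow
  rw [← cfc_mul _ _ ρ (hcont _) (hcont _)]
  exact cfc_congr fun x hx => (Real.rpow_add (pos_of_mem_spectrum hρ hx) s t).symm

theorem rpow_zero (hρ : ρ.IsHermitian) : rpow ρ 0 = 1 := by
  unfold rpow
  simp only [Real.rpow_zero]
  exact cfc_const_one ℝ ρ (ha := hρ)

theorem rpow_one (hρ : ρ.IsHermitian) : rpow ρ 1 = ρ := by
  unfold rpow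
  simp only [Real.rpow_one]
  exact cfc_id' ℝ ρ (ha := hρ)

theorem rpow_mul_rpow_neg (hρ : ρ.PosDef) (s : ℝ) : rpow ρ s * rpow ρ (-s) = 1 := by
  rw [rpow_mul_rpow hρ, add_neg_cancel, rpow_zero hρ.isHermitian]

theorem rpow_neg_mul_rpow (hρ : ρ.PosDef) (s : ℝ) : rpow ρ (-s) * rpow ρ s = 1 := by
  rw [rpow_mul_rpow hρ, neg_add_cancel, rpow_zero hρ.isHermitian]

end Powers

open scoped MatrixOrder Matrix.Norms.L2Operator in
theorem posDef_exp {n : Type*} [Fintype n] [DecidableEq n] {A : Matrix n n ℂ}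
    (hA : A.IsHermitian) : (NormedSpace.exp A).PosDef :=
  (Matrix.nonneg_iff_posSemidef.1 hA.isSelfAdjoint.exp_nonneg).posDef_iff_isUnit.2
    (Matrix.isUnit_exp A)

section Gibbs

variable {d : ℕ} {H : Op d}

theorem posDef_exp_neg_smul (hH : H.IsHermitian) (β : ℝ) :
    (NormedSpace.exp ((-(β : ℂ)) • H)).PosDef :=
  posDef_exp (hH.smul (by simp [isSelfAdjoint_iff]))

theorem gibbs_posDef [NeZero d] (hH : H.IsHermitian) (β : ℝ) : (gibbs H β).PosDef :=
  (posDef_exp_neg_smul hH β).smul (inv_pos.2 (posDef_exp_neg_smul hH β).trace_pos)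

theorem gibbs_trace [NeZero d] (hH : H.IsHermitian) (β : ℝ) : (gibbs H β).trace = 1 := by
  rw [gibbs, Matrix.trace_smul, smul_eq_mul,
    inv_mul_cancel₀ (posDef_exp_neg_smul hH β).trace_pos.ne']

theorem gibbs_commute {X : Op d} (h : Commute X H) (β : ℝ) : Commute (gibbs H β) X :=
  ((h.symm.smul_left (-(β : ℂ))).exp_left).smul_left _

end Gibbs

open scoped MatrixOrder Matrix.Norms.L2Operator in
theorem exists_add_smul_posSemidef {n : Type*} [Finite n] {A X : Matrix n n ℂ}
    (hA : A.PosDef) (hX : X.IsHermitian) : ∃ c : ℝ, (X + (c : ℂ) • A).PosSemidef := by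
  classical
  have := Fintype.ofFinite n
  rcases subsingleton_or_nontrivial (Matrix n n ℂ) with h | h
  · exact ⟨0, Subsingleton.elim 0 (X + _) ▸ Matrix.PosSemidef.zero⟩
  obtain ⟨r, hr, hrA⟩ := (CFC.exists_pos_algebraMap_le_iff (a := A) hA.isHermitian).2 fun _ =>
    pos_of_mem_spectrum hA
  refine ⟨‖X‖ / r, Matrix.nonneg_iff_posSemidef.1 ?_⟩
  have hrA' : algebraMap ℝ (Matrix n n ℂ) ‖X‖ ≤ (‖X‖ / r) • A := by
    have := smul_le_smul_of_nonneg_left hrA (show 0 ≤ ‖X‖ / r by positivity)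
    rwa [Algebra.algebraMap_eq_smul_one, smul_smul, div_mul_cancel₀ _ hr.ne',
      ← Algebra.algebraMap_eq_smul_one] at this
  have hX' : -(algebraMap ℝ (Matrix n n ℂ) ‖X‖) ≤ X :=
    IsSelfAdjoint.neg_algebraMap_norm_le_self hX
  rw [Complex.coe_smul]
  simpa using add_le_add hX' hrA'

/-! ### The Hilbert-Schmidt norm -/

section HilbertSchmidt

variable {n : Type*}

/-- Matrices as vectors of the Hilbert space in which the inner product is `tr (A† B)`. -/
def hsVec : Matrix n n ℂ ≃ₗ[ℂ] EuclideanSpace ℂ (n × n) :=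
  (LinearEquiv.curry ℂ ℂ n n).symm.trans (WithLp.linearEquiv 2 ℂ (n × n → ℂ)).symm

/-- The Hilbert-Schmidt norm `√(tr (A† A))`. -/
def hsNorm [Fintype n] (A : Matrix n n ℂ) : ℝ := ‖hsVec A‖

theorem hsVec_apply (A : Matrix n n ℂ) (p : n × n) : hsVec A p = A p.1 p.2 := rfl

variable [Fintype n]

theorem hsNorm_nonneg (A : Matrix n n ℂ) : 0 ≤ hsNorm A := norm_nonneg _

theorem inner_hsVec (A B : Matrix n n ℂ) :
    inner ℂ (hsVec A) (hsVec B) = (A.conjTranspose * B).trace := by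
  rw [PiLp.inner_apply, Fintype.sum_prod_type, Finset.sum_comm]
  simp only [hsVec_apply, Matrix.trace, Matrix.diag_apply, Matrix.mul_apply,
    Matrix.conjTranspose_apply, RCLike.inner_apply]
  exact Finset.sum_congr rfl fun i _ => Finset.sum_congr rfl fun j _ => mul_comm _ _

theorem hsNorm_sq (A : Matrix n n ℂ) : hsNorm A ^ 2 = (A.conjTranspose * A).trace.re := by
  rw [← inner_hsVec]
  exact (inner_self_eq_norm_sq (𝕜 := ℂ) (hsVec A)).symm

theorem norm_trace_conjTranspose_mul_le (A B : Matrix n n ℂ) :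
    ‖(A.conjTranspose * B).trace‖ ≤ hsNorm A * hsNorm B := by
  rw [← inner_hsVec]
  exact norm_inner_le_norm _ _

theorem hsNorm_conjTranspose (X : Matrix n n ℂ) : hsNorm X.conjTranspose = hsNorm X := by
  refine (sq_eq_sq₀ (hsNorm_nonneg _) (hsNorm_nonneg _)).1 ?_
  rw [hsNorm_sq, hsNorm_sq, Matrix.conjTranspose_conjTranspose, Matrix.trace_mul_comm]

variable [DecidableEq n] {ι : Type*} [Fintype ι] {K : ι → Matrix n n ℂ}

theorem sum_hsNorm_mul_sq (hK : ∑ j, (K j).conjTranspose * K j = 1) (X : Matrix n n ℂ) :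
    ∑ j, hsNorm (K j * X) ^ 2 = hsNorm X ^ 2 := by
  simp only [hsNorm_sq, ← Complex.re_sum, ← Matrix.trace_sum, Matrix.conjTranspose_mul,
    Matrix.mul_assoc, ← Matrix.mul_sum]
  simp only [← Matrix.mul_assoc, ← Matrix.sum_mul, hK, one_mul]

theorem hsNorm_sum_mul_mul_conjTranspose_le (hK : ∑ j, (K j).conjTranspose * K j = 1)
    (hK' : ∑ j, K j * (K j).conjTranspose = 1) (X : Matrix n n ℂ) :
    hsNorm (∑ j, K j * X * (K j).conjTranspose) ≤ hsNorm X := by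
  set Y := ∑ j, K j * X * (K j).conjTranspose with hY
  have hright : ∑ j, hsNorm (X * (K j).conjTranspose) ^ 2 = hsNorm X ^ 2 := by
    rw [← hsNorm_conjTranspose X, ← sum_hsNorm_mul_sq hK]
    refine Finset.sum_congr rfl fun j _ => ?_
    rw [← hsNorm_conjTranspose, Matrix.conjTranspose_mul, Matrix.conjTranspose_conjTranspose]
  have hleft : ∑ j, hsNorm ((K j).conjTranspose * Y) ^ 2 = hsNorm Y ^ 2 :=
    sum_hsNorm_mul_sq (K := fun j => (K j).conjTranspose)
      (by simpa only [Matrix.conjTranspose_conjTranspose] using hK') Y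
  have hYY : (Y.conjTranspose * Y).trace =
      ∑ j, (((K j).conjTranspose * Y).conjTranspose * (X * (K j).conjTranspose)).trace := by
    conv_lhs => rw [hY, Matrix.mul_sum, Matrix.trace_sum]
    simp only [Matrix.conjTranspose_mul, Matrix.conjTranspose_conjTranspose, Matrix.mul_assoc, hY]
  have hmain : hsNorm Y ^ 2 ≤ hsNorm Y * hsNorm X := by
    calc hsNorm Y ^ 2
        ≤ ∑ j, hsNorm ((K j).conjTranspose * Y) * hsNorm (X * (K j).conjTranspose) := by
          rw [hsNorm_sq, hYY, Complex.re_sum]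
          exact Finset.sum_le_sum fun j _ =>
            (Complex.re_le_norm _).trans (norm_trace_conjTranspose_mul_le _ _)
      _ ≤ √(hsNorm Y ^ 2) * √(hsNorm X ^ 2) := by
          rw [← hleft, ← hright]
          exact Real.sum_mul_le_sqrt_mul_sqrt _ _ _
      _ = hsNorm Y * hsNorm X := by
          rw [Real.sqrt_sq (hsNorm_nonneg _), Real.sqrt_sq (hsNorm_nonneg _)]
  rcases (hsNorm_nonneg Y).eq_or_lt with h | h
  · exact h.symm.trans_le (hsNorm_nonneg _)
  · exact le_of_mul_le_mul_left (by rwa [← sq]) h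

end HilbertSchmidt

theorem norm_le_of_symmetric_gap {E : Type*} [NormedAddCommGroup E] [InnerProductSpace ℂ E]
    [FiniteDimensional ℂ E] {T : E →ₗ[ℂ] E} (hT : T.IsSymmetric) {v : E} {q : ℝ} (hq : 0 ≤ q)
    (hfix : ∀ w, T w = w → ∃ c : ℂ, w = c • v)
    (heig : ∀ μ : ℝ, μ ≠ 1 → Module.End.HasEigenvalue T (μ : ℂ) → |μ| ≤ q)
    {w : E} (hw : inner ℂ v w = 0) : ‖T w‖ ≤ q * ‖w‖ := by
  have hn : Module.finrank ℂ E = Module.finrank ℂ E := rfl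
  let b := hT.eigenvectorBasis hn
  have hcoord (i) : ‖b.repr (T w) i‖ ≤ q * ‖b.repr w i‖ := by
    rw [hT.eigenvectorBasis_apply_self_apply hn, norm_mul]
    by_cases h : hT.eigenvalues hn i = 1
    · obtain ⟨c, hc⟩ := hfix (b i) (by rw [hT.apply_eigenvectorBasis hn, h]; simp [b])
      have hzero : b.repr w i = 0 := by
        rw [b.repr_apply_apply, hc, inner_smul_left, hw, mul_zero]
      simp only [b] at hzero ⊢
      simp [hzero]
    · refine mul_le_mul_of_nonneg_right ?_ (norm_nonneg _)
      simpa using heig _ h (hT.hasEigenvalue_eigenvalues hn i)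
  rw [← b.repr.norm_map (T w), ← b.repr.norm_map w, EuclideanSpace.norm_eq,
    EuclideanSpace.norm_eq, ← Real.sqrt_sq hq, ← Real.sqrt_mul (sq_nonneg q), Finset.mul_sum]
  refine Real.sqrt_le_sqrt (Finset.sum_le_sum fun i _ => ?_)
  rw [← mul_pow]
  exact pow_le_pow_left₀ (norm_nonneg _) (hcoord i) 2

/-! ### Channels and Gibbs samplers -/

section Channel

variable {d : ℕ} {N : SuperOp d}

theorem IsChannel.trace_apply (hN : IsChannel N) (X : Op d) : (N X).trace = X.trace := by
  obtain ⟨k, K, hK, hone⟩ := hN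
  simp only [hK, Matrix.trace_sum, fun u => Matrix.trace_mul_cycle (K u) X (K u).conjTranspose]
  rw [← Matrix.trace_sum, ← Matrix.sum_mul, hone, one_mul]

theorem IsChannel.conjTranspose_apply (hN : IsChannel N) (X : Op d) :
    (N X).conjTranspose = N X.conjTranspose := by
  obtain ⟨k, K, hK, -⟩ := hN
  simp only [hK, Matrix.conjTranspose_sum, Matrix.conjTranspose_mul,
    Matrix.conjTranspose_conjTranspose, Matrix.mul_assoc]

theorem IsChannel.posSemidef_apply (hN : IsChannel N) {X : Op d} (hX : X.PosSemidef) :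
    (N X).PosSemidef := by
  obtain ⟨k, K, hK, -⟩ := hN
  rw [hK]
  exact Matrix.posSemidef_sum _ fun u _ => hX.mul_mul_conjTranspose_same _

theorem IsChannel.trace_pow_apply (hN : IsChannel N) (t : ℕ) (X : Op d) :
    ((N ^ t) X).trace = X.trace := by
  induction t with
  | zero => rw [pow_zero, Module.End.one_apply]
  | succ t ih => rw [pow_succ', Module.End.mul_apply, hN.trace_apply, ih]

theorem IsChannel.posSemidef_pow_apply (hN : IsChannel N) (t : ℕ) {X : Op d}
    (hX : X.PosSemidef) : ((N ^ t) X).PosSemidef := by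
  induction t with
  | zero => rwa [pow_zero, Module.End.one_apply]
  | succ t ih =>
    rw [pow_succ', Module.End.mul_apply]
    exact hN.posSemidef_apply ih

theorem IsChannel.isState_pow_apply (hN : IsChannel N) (t : ℕ) {σ : Op d} (hσ : IsState σ) :
    IsState ((N ^ t) σ) :=
  ⟨hN.posSemidef_pow_apply t hσ.1, by rw [hN.trace_pow_apply, hσ.2]⟩

end Channel

section Weighted

variable {d : ℕ} {ρ : Op d}

/-- The isometry `X ↦ ρ^(-(1-s)/2) X ρ^(-s/2)` onto a Hilbert space. It turns the `s`-detailed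
balance of a map on observables into the symmetry of the dual map on states. -/
def weightedVec (hρ : ρ.PosDef) (s : ℝ) : Op d ≃ₗ[ℂ] EuclideanSpace ℂ (Fin d × Fin d) :=
  (LinearEquiv.ofLinearMap
    (LinearMap.mulLeftRight ℂ (rpow ρ (-((1 - s) / 2)), rpow ρ (-(s / 2))))
    (LinearMap.mulLeftRight ℂ (rpow ρ ((1 - s) / 2), rpow ρ (s / 2)))
    (LinearMap.ext fun X => by
      simp only [LinearMap.comp_apply, LinearMap.mulLeftRight_apply, LinearMap.id_apply, mul_assoc,
        rpow_mul_rpow_neg hρ, mul_one]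
      rw [← mul_assoc, rpow_neg_mul_rpow hρ, one_mul])
    (LinearMap.ext fun X => by
      simp only [LinearMap.comp_apply, LinearMap.mulLeftRight_apply, LinearMap.id_apply, mul_assoc,
        rpow_neg_mul_rpow hρ, mul_one]
      rw [← mul_assoc, rpow_mul_rpow_neg hρ, one_mul]) : Op d ≃ₗ[ℂ] Op d).trans hsVec

theorem weightedVec_apply (hρ : ρ.PosDef) (s : ℝ) (X : Op d) :
    weightedVec hρ s X = hsVec (rpow ρ (-((1 - s) / 2)) * X * rpow ρ (-(s / 2))) := rfl

/-- The norm of states that is contracted by maps satisfying `s`-detailed balance. -/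
def weightedNorm (hρ : ρ.PosDef) (s : ℝ) (X : Op d) : ℝ := ‖weightedVec hρ s X‖

theorem weightedNorm_nonneg (hρ : ρ.PosDef) (s : ℝ) (X : Op d) : 0 ≤ weightedNorm hρ s X :=
  norm_nonneg _

theorem inner_weightedVec (hρ : ρ.PosDef) (s : ℝ) (Z X : Op d) :
    inner ℂ (weightedVec hρ s (rpow ρ (1 - s) * Z * rpow ρ s)) (weightedVec hρ s X) =
      (Z.conjTranspose * X).trace := by
  have hgram : rpow ρ (-((1 - s) / 2)) * (rpow ρ (1 - s) * Z * rpow ρ s) * rpow ρ (-(s / 2)) =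
      rpow ρ ((1 - s) / 2) * Z * rpow ρ (s / 2) := by
    calc _ = rpow ρ (-((1 - s) / 2)) * rpow ρ (1 - s) * Z * (rpow ρ s * rpow ρ (-(s / 2))) := by
          simp only [mul_assoc]
      _ = _ := by rw [rpow_mul_rpow hρ, rpow_mul_rpow hρ]; ring_nf
  rw [weightedVec_apply, weightedVec_apply, inner_hsVec, hgram]
  simp only [Matrix.conjTranspose_mul, (rpow_isHermitian ρ _).eq]
  rw [mul_assoc, Matrix.trace_mul_comm]
  calc _ = (Z.conjTranspose * (rpow ρ ((1 - s) / 2) * rpow ρ (-((1 - s) / 2))) * X *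
          (rpow ρ (-(s / 2)) * rpow ρ (s / 2))).trace := by simp only [mul_assoc]
    _ = (Z.conjTranspose * X).trace := by
        rw [rpow_mul_rpow_neg hρ, rpow_neg_mul_rpow hρ, mul_one, mul_one]

theorem inner_weightedVec_self (hρ : ρ.PosDef) (s : ℝ) (X : Op d) :
    inner ℂ (weightedVec hρ s ρ) (weightedVec hρ s X) = X.trace := by
  have h := inner_weightedVec hρ s 1 X
  rwa [mul_one, rpow_mul_rpow hρ, sub_add_cancel, rpow_one hρ.isHermitian,
    Matrix.conjTranspose_one, one_mul] at h

theorem trace_conjTranspose_dual_mul (T : SuperOp d) (A Z : Op d) :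
    ((dual T A).conjTranspose * Z).trace = (A.conjTranspose * T Z).trace := by
  apply star_injective
  rw [← Matrix.trace_conjTranspose, ← Matrix.trace_conjTranspose, Matrix.conjTranspose_mul,
    Matrix.conjTranspose_mul, Matrix.conjTranspose_conjTranspose,
    Matrix.conjTranspose_conjTranspose, trace_conjTranspose_mul_dual]

theorem DetailedBalance.apply_rpow_mul_mul_rpow {s : ℝ} {N : SuperOp d}
    (hN : DetailedBalance ρ s N) (B : Op d) :
    N (rpow ρ (1 - s) * B * rpow ρ s) = rpow ρ (1 - s) * dual N B * rpow ρ s := by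
  refine Matrix.ext_iff_trace_mul_left.2 fun A => ?_
  have h := hN A.conjTranspose B
  simp only [weighted, Matrix.conjTranspose_conjTranspose, mul_assoc] at h
  rw [trace_conjTranspose_dual_mul, Matrix.conjTranspose_conjTranspose] at h
  simpa only [mul_assoc] using h.symm

theorem DetailedBalance.isSymmetric {s : ℝ} {N : SuperOp d} (hN : DetailedBalance ρ s N)
    (hρ : ρ.PosDef) : ((weightedVec hρ s).conjAlgEquiv ℂ N).IsSymmetric := by
  have hsurj (x : EuclideanSpace ℂ (Fin d × Fin d)) :
      ∃ A, weightedVec hρ s (rpow ρ (1 - s) * A * rpow ρ s) = x := by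
    obtain ⟨X, rfl⟩ := (weightedVec hρ s).surjective x
    refine ⟨rpow ρ (-(1 - s)) * X * rpow ρ (-s), congrArg _ ?_⟩
    rw [mul_assoc, mul_assoc, rpow_neg_mul_rpow hρ, mul_one, ← mul_assoc, rpow_mul_rpow_neg hρ,
      one_mul]
  intro x y
  obtain ⟨A, rfl⟩ := hsurj x
  obtain ⟨B, rfl⟩ := hsurj y
  simp only [LinearEquiv.conjAlgEquiv_apply, LinearMap.comp_apply, LinearEquiv.coe_coe,
    LinearEquiv.symm_apply_apply]
  rw [inner_weightedVec, hN.apply_rpow_mul_mul_rpow A, inner_weightedVec,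
    trace_conjTranspose_dual_mul]

end Weighted

section Sampler

variable {d : ℕ} {ρ : Op d} {s : ℝ} {N : SuperOp d}

theorem IsGibbsSampler.exists_eq_smul_of_isHermitian (hN : IsGibbsSampler ρ s N) (hρ : ρ.PosDef)
    {X : Op d} (hX : X.IsHermitian) (hfix : N X = X) : ∃ c : ℂ, X = c • ρ := by
  obtain ⟨c, hc⟩ := exists_add_smul_posSemidef hρ hX
  suffices ∃ b : ℂ, X + (c : ℂ) • ρ = b • ρ by
    obtain ⟨b, hb⟩ := this
    exact ⟨b - c, by rw [sub_smul, ← hb, add_sub_cancel_right]⟩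
  set Z := X + (c : ℂ) • ρ with hZ
  have hNZ : N Z = Z := by rw [hZ, map_add, map_smul, hfix, hN.fixed]
  by_cases hZ0 : Z.trace = 0
  · exact ⟨0, by rw [zero_smul, hc.trace_eq_zero_iff.1 hZ0]⟩
  · have hstate : IsState (Z.trace⁻¹ • Z) :=
      ⟨hc.smul (inv_nonneg.2 hc.trace_nonneg), by
        rw [Matrix.trace_smul, smul_eq_mul, inv_mul_cancel₀ hZ0]⟩
    exact ⟨Z.trace, (inv_smul_eq_iff₀ hZ0).1 (hN.unique _ hstate (by rw [map_smul, hNZ]))⟩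

open scoped ComplexStarModule in
theorem IsGibbsSampler.exists_eq_smul (hN : IsGibbsSampler ρ s N) (hρ : ρ.PosDef)
    {X : Op d} (hfix : N X = X) : ∃ c : ℂ, X = c • ρ := by
  have hfix' : N (star X) = star X := by
    rw [Matrix.star_eq_conjTranspose, ← hN.channel.conjTranspose_apply, hfix]
  obtain ⟨a, ha⟩ := hN.exists_eq_smul_of_isHermitian hρ (X := (ℜ X : Op d)) (ℜ X).2 (by
    rw [realPart_apply_coe, LinearMap.map_smul_of_tower, map_add, hfix, hfix'])
  obtain ⟨b, hb⟩ := hN.exists_eq_smul_of_isHermitian hρ (X := (ℑ X : Op d)) (ℑ X).2 (by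
    rw [imaginaryPart_apply_coe, map_smul, LinearMap.map_smul_of_tower, map_sub, hfix, hfix'])
  exact ⟨a + Complex.I * b, by
    rw [add_smul, mul_smul, ← ha, ← hb, realPart_add_I_smul_imaginaryPart]⟩

theorem IsGibbsSampler.eigenvalue_mem_Icc (hN : IsGibbsSampler ρ s N) {μ : ℝ}
    (h : Module.End.HasEigenvalue N (μ : ℂ)) : μ ∈ Set.Icc 0 1 := by
  obtain ⟨x, hx, hxμ⟩ := hN.spectrum_subset h.mem_spectrum
  rwa [← Complex.ofReal_injective hxμ]

theorem IsGibbsSampler.eigenvalue_le (hN : IsGibbsSampler ρ s N) {μ : ℝ} (hμ : μ ≠ 1)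
    (h : Module.End.HasEigenvalue N (μ : ℂ)) : μ ≤ 1 - gap N := by
  rw [gap, sub_sub_cancel]
  exact le_csSup ⟨1, fun x hx => (hN.eigenvalue_mem_Icc hx.2).2⟩ ⟨hμ, h⟩

theorem IsGibbsSampler.gap_le_one (hN : IsGibbsSampler ρ s N) : gap N ≤ 1 := by
  rw [gap, sub_le_self_iff]
  exact Real.sSup_nonneg fun x hx => (hN.eigenvalue_mem_Icc hx.2).1

theorem IsGibbsSampler.weightedNorm_apply_le (hN : IsGibbsSampler ρ s N) (hρ : ρ.PosDef)
    {X : Op d} (hX : X.trace = 0) :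
    weightedNorm hρ s (N X) ≤ (1 - gap N) * weightedNorm hρ s X := by
  let w := weightedVec hρ s
  have hfix (x) (hx : w.conjAlgEquiv ℂ N x = x) : ∃ c : ℂ, x = c • w ρ := by
    obtain ⟨A, rfl⟩ := w.surjective x
    have hA : w (N A) = w A := by simpa [LinearEquiv.conjAlgEquiv_apply] using hx
    obtain ⟨c, hc⟩ := hN.exists_eq_smul hρ (w.injective hA)
    exact ⟨c, by rw [← map_smul, ← hc]⟩
  have heig (μ : ℝ) (hμ : μ ≠ 1) (h : Module.End.HasEigenvalue (w.conjAlgEquiv ℂ N) (μ : ℂ)) :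
      |μ| ≤ 1 - gap N := by
    rw [Module.End.hasEigenvalue_iff_mem_spectrum, AlgEquiv.spectrum_eq,
      ← Module.End.hasEigenvalue_iff_mem_spectrum] at h
    rw [abs_of_nonneg (hN.eigenvalue_mem_Icc h).1]
    exact hN.eigenvalue_le hμ h
  have h := norm_le_of_symmetric_gap (hN.balance.isSymmetric hρ) (sub_nonneg.2 hN.gap_le_one)
    hfix heig (w := w X) (by rw [inner_weightedVec_self, hX])
  simpa only [LinearEquiv.conjAlgEquiv_apply, LinearMap.comp_apply, LinearEquiv.coe_coe, w,
    LinearEquiv.symm_apply_apply, weightedNorm] using h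

theorem IsGibbsSampler.weightedNorm_pow_apply_le (hN : IsGibbsSampler ρ s N) (hρ : ρ.PosDef)
    {X : Op d} (hX : X.trace = 0) (t : ℕ) :
    weightedNorm hρ s ((N ^ t) X) ≤ (1 - gap N) ^ t * weightedNorm hρ s X := by
  induction t with
  | zero => rw [pow_zero, pow_zero, one_mul, Module.End.one_apply]
  | succ t ih =>
    rw [pow_succ', Module.End.mul_apply, pow_succ', mul_assoc]
    exact (hN.weightedNorm_apply_le hρ (by rw [hN.channel.trace_pow_apply, hX])).trans
      (mul_le_mul_of_nonneg_left ih (sub_nonneg.2 hN.gap_le_one))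

theorem IsGibbsSampler.pow_fixed (hN : IsGibbsSampler ρ s N) (t : ℕ) : (N ^ t) ρ = ρ := by
  rw [Module.End.coe_pow]
  exact Function.iterate_fixed hN.fixed t

end Sampler

/-! ### The trace norm and mixing -/

section TraceNorm

theorem trace_cfc {n : Type*} [Fintype n] [DecidableEq n] {A : Matrix n n ℂ} (hA : A.IsHermitian)
    (f : ℝ → ℝ) : (cfc f A).trace = ((∑ i, f (hA.eigenvalues i) : ℝ) : ℂ) := by
  rw [hA.cfc_eq, Matrix.IsHermitian.cfc, Unitary.conjStarAlgAut_apply, Matrix.trace_mul_cycle,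
    Unitary.coe_star_mul_self, one_mul, Matrix.trace_diagonal, Complex.ofReal_sum]
  rfl

theorem cfc_sq {n : Type*} [Fintype n] [DecidableEq n] {A : Matrix n n ℂ} (hA : A.IsHermitian) :
    cfc (fun x : ℝ => x ^ 2) A = A * A := by
  have hA' : IsSelfAdjoint A := hA
  rw [cfc_pow_id (R := ℝ) A 2, sq]

variable {d : ℕ}

theorem traceNorm_of_isHermitian {A : Op d} (hA : A.IsHermitian) :
    traceNorm A = ∑ i, |hA.eigenvalues i| := by
  have htrace := trace_cfc (Matrix.isHermitian_conjTranspose_mul_self A) Real.sqrt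
  have habs : cfc Real.sqrt (A.conjTranspose * A) = cfc (fun x : ℝ => |x|) A := by
    have hA' : IsSelfAdjoint A := hA
    rw [hA.eq, ← cfc_sq hA, ← cfc_comp' Real.sqrt (fun x : ℝ => x ^ 2) A]
    simp only [Real.sqrt_sq_eq_abs]
  rw [habs, trace_cfc hA] at htrace
  exact (Complex.ofReal_injective htrace).symm

theorem traceNorm_le_sqrt_mul_hsNorm (A : Op d) : traceNorm A ≤ √d * hsNorm A := by
  let hB := Matrix.isHermitian_conjTranspose_mul_self A
  have hnonneg (i) : 0 ≤ hB.eigenvalues i :=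
    (Matrix.posSemidef_conjTranspose_mul_self A).eigenvalues_nonneg i
  have htrace : ∑ i, hB.eigenvalues i = hsNorm A ^ 2 := by
    rw [hsNorm_sq, hB.trace_eq_sum_eigenvalues, Complex.re_sum]
    rfl
  refine (Real.le_sqrt_of_sq_le ?_).trans_eq
    ((Real.sqrt_mul (Nat.cast_nonneg d) _).trans (by rw [Real.sqrt_sq (hsNorm_nonneg A)]))
  simpa only [traceNorm, Real.sq_sqrt (hnonneg _), Finset.card_univ, Fintype.card_fin, htrace]
    using sq_sum_le_card_mul_sum_sq (s := Finset.univ) (f := fun i => √(hB.eigenvalues i))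

theorem IsState.hsNorm_le_one {σ : Op d} (hσ : IsState σ) : hsNorm σ ≤ 1 := by
  have hH := hσ.1.isHermitian
  have hsum : ∑ i, hH.eigenvalues i = 1 := by
    have := hH.trace_eq_sum_eigenvalues.symm.trans hσ.2
    exact Complex.ofReal_injective ((Complex.ofReal_sum _ _).trans this)
  rw [← abs_of_nonneg (hsNorm_nonneg σ), abs_le_one_iff_mul_self_le_one, ← sq, hsNorm_sq, hH.eq,
    ← cfc_sq hH, trace_cfc hH, Complex.ofReal_re]
  simpa only [hsum, one_pow] using
    Finset.sum_sq_le_sq_sum_of_nonneg fun i (_ : i ∈ Finset.univ) => hσ.1.eigenvalues_nonneg i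

theorem exists_isState_sum_eigenvalues_smul {X : Op d} (hX : X.IsHermitian) :
    ∃ P : Fin d → Op d, (∀ i, IsState (P i)) ∧ X = ∑ i, hX.eigenvalues i • P i := by
  set U : Op d := ↑hX.eigenvectorUnitary with hU
  refine ⟨fun i => U * Matrix.single i i 1 * U.conjTranspose, fun i => ⟨?_, ?_⟩, ?_⟩
  · refine Matrix.PosSemidef.mul_mul_conjTranspose_same ?_ U
    rw [← Matrix.diagonal_single]
    exact Matrix.PosSemidef.diagonal (Pi.single_nonneg.2 zero_le_one)
  · rw [Matrix.trace_mul_cycle, ← Matrix.star_eq_conjTranspose, Unitary.coe_star_mul_self, one_mul,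
      Matrix.trace_single_eq_same]
  · conv_lhs => rw [hX.spectral_theorem, Unitary.conjStarAlgAut_apply,
      ← Matrix.sum_single_eq_diagonal, Matrix.mul_sum, Matrix.sum_mul]
    refine Finset.sum_congr rfl fun i _ => ?_
    rw [← smul_mul_assoc, ← mul_smul_comm, Matrix.smul_single, ← hU, Complex.real_smul, mul_one]
    rfl

theorem abs_le_traceNorm (g : Op d →ₗ[ℝ] ℝ) (hg : ∀ σ, IsState σ → g σ ∈ Set.Icc 0 1) {X : Op d}
    (hX : X.IsHermitian) : |g X| ≤ traceNorm X := by
  obtain ⟨P, hP, hXP⟩ := exists_isState_sum_eigenvalues_smul hX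
  calc |g X| = |∑ i, hX.eigenvalues i * g (P i)| := by
        conv_lhs => rw [hXP, map_sum]
        simp only [map_smul, smul_eq_mul]
    _ ≤ ∑ i, |hX.eigenvalues i * g (P i)| := Finset.abs_sum_le_sum_abs _ _
    _ ≤ ∑ i, |hX.eigenvalues i| := Finset.sum_le_sum fun i _ => by
        rw [abs_mul, abs_of_nonneg (hg _ (hP i)).1]
        exact mul_le_of_le_one_right (abs_nonneg _) (hg _ (hP i)).2
    _ = traceNorm X := (traceNorm_of_isHermitian hX).symm

end TraceNorm

section Mixing

variable {d : ℕ} {ρ : Op d} {s : ℝ} {N : SuperOp d}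

theorem IsGibbsSampler.exists_traceNorm_pow_apply_le (hN : IsGibbsSampler ρ s N) (hρ : ρ.PosDef) :
    ∃ c : ℝ, ∀ (t : ℕ) (X : Op d), X.trace = 0 →
      traceNorm ((N ^ t) X) ≤ c * (1 - gap N) ^ t * hsNorm X := by
  let w := weightedVec hρ s
  let A := LinearMap.toContinuousLinearMap (w.symm.trans hsVec).toLinearMap
  let B := LinearMap.toContinuousLinearMap (hsVec.symm.trans w).toLinearMap
  have hA (X : Op d) : hsNorm X ≤ ‖A‖ * weightedNorm hρ s X := by
    simpa [A, hsNorm, weightedNorm, w] using A.le_opNorm (w X)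
  have hB (X : Op d) : weightedNorm hρ s X ≤ ‖B‖ * hsNorm X := by
    simpa [B, hsNorm, weightedNorm, w] using B.le_opNorm (hsVec X)
  have hgap : 0 ≤ 1 - gap N := sub_nonneg.2 hN.gap_le_one
  refine ⟨√d * (‖A‖ * ‖B‖), fun t X hX => ?_⟩
  calc traceNorm ((N ^ t) X) ≤ √d * hsNorm ((N ^ t) X) := traceNorm_le_sqrt_mul_hsNorm _
    _ ≤ √d * (‖A‖ * ((1 - gap N) ^ t * (‖B‖ * hsNorm X))) := by
        gcongr
        refine (hA _).trans ?_
        gcongr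
        refine (hN.weightedNorm_pow_apply_le hρ hX t).trans ?_
        gcongr
        exact hB X
    _ = √d * (‖A‖ * ‖B‖) * (1 - gap N) ^ t * hsNorm X := by ring

theorem IsGibbsSampler.exists_forall_traceNorm_le (hN : IsGibbsSampler ρ s N) (hρ : ρ.PosDef)
    (hρ1 : ρ.trace = 1) (hgap : 0 < gap N) {η : ℝ} (hη : 0 < η) :
    ∃ t : ℕ, ∀ σ : Op d, IsState σ → traceNorm ((N ^ t) σ - ρ) ≤ η := by
  obtain ⟨c, hc⟩ := hN.exists_traceNorm_pow_apply_le hρ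
  have hgap' : 0 ≤ 1 - gap N := sub_nonneg.2 hN.gap_le_one
  have hlim : Filter.Tendsto (fun t : ℕ => |c| * (1 - gap N) ^ t * 2) Filter.atTop (nhds 0) := by
    simpa using ((tendsto_pow_atTop_nhds_zero_of_lt_one hgap'
      (sub_lt_self 1 hgap)).const_mul |c|).mul_const 2
  obtain ⟨t, ht⟩ := (hlim.eventually_le_const hη).exists
  refine ⟨t, fun σ hσ => ?_⟩
  have hdist : hsNorm (σ - ρ) ≤ 2 :=
    calc hsNorm (σ - ρ) ≤ hsNorm σ + hsNorm ρ := by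
          simpa only [hsNorm, map_sub] using norm_sub_le (hsVec σ) (hsVec ρ)
      _ ≤ 2 := by linarith [hσ.hsNorm_le_one, IsState.hsNorm_le_one ⟨hρ.posSemidef, hρ1⟩]
  have htrace : (σ - ρ).trace = 0 := by rw [Matrix.trace_sub, hσ.2, hρ1, sub_self]
  calc traceNorm ((N ^ t) σ - ρ) = traceNorm ((N ^ t) (σ - ρ)) := by
        rw [map_sub, hN.pow_fixed t]
    _ ≤ c * (1 - gap N) ^ t * hsNorm (σ - ρ) := hc t _ htrace
    _ ≤ |c| * (1 - gap N) ^ t * 2 := by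
        have := hsNorm_nonneg (σ - ρ)
        gcongr
        exact le_abs_self c
    _ ≤ η := ht

theorem IsGibbsSampler.traceNorm_pow_sub_le (hN : IsGibbsSampler ρ s N) (hρ : ρ.PosDef)
    (hρ1 : ρ.trace = 1) (hgap : 0 < gap N) {η : ℝ} (hη : 0 < η) {T : ℕ}
    (hT : mixingTime ρ N η ≤ T) {σ : Op d} (hσ : IsState σ) :
    traceNorm ((N ^ T) σ - ρ) ≤ η := by
  have hmix : ∀ σ : Op d, IsState σ → traceNorm ((N ^ mixingTime ρ N η) σ - ρ) ≤ η :=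
    Nat.sInf_mem (hN.exists_forall_traceNorm_le hρ hρ1 hgap hη)
  have h := hmix _ (hN.channel.isState_pow_apply (T - mixingTime ρ N η) hσ)
  rwa [← Module.End.mul_apply, ← pow_add, Nat.add_sub_cancel' hT] at h

end Mixing

/-! ### Moments of the outcomes along a trajectory -/

section Trajectory

variable {R V J : Type*} [CommSemiring R] [AddCommMonoid V] [Module R V]

/-- The branch of an instrument along a list of outcomes, the head of the list acting first. -/
def trajectory (Φ : J → Module.End R V) : List J → Module.End R V
  | [] => 1
  | j :: js => trajectory Φ js * Φ j

variable [Fintype J]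

/-- The instrument summed over its outcomes with weights `y`. -/
def weightedSum (Φ : J → Module.End R V) (y : J → R) : Module.End R V := ∑ j, y j • Φ j

/-- The expectation of `f`, a function of `k` consecutive outcomes, as a functional of the initial
state; `τ` is the functional that turns unnormalized states into probabilities. -/
def outcomeExpect (Φ : J → Module.End R V) (τ : V →ₗ[R] R) {k : ℕ} (f : (Fin k → J) → R) :
    V →ₗ[R] R :=
  ∑ e, f e • τ ∘ₗ trajectory Φ (List.ofFn e)

variable {Φ : J → Module.End R V} {τ : V →ₗ[R] R}

theorem weightedSum_apply (y : J → R) (X : V) : weightedSum Φ y X = ∑ j, y j • Φ j X := by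
  simp only [weightedSum, LinearMap.sum_apply, LinearMap.smul_apply]

theorem outcomeExpect_apply {k : ℕ} (f : (Fin k → J) → R) (X : V) :
    outcomeExpect Φ τ f X = ∑ e, f e * τ (trajectory Φ (List.ofFn e) X) := by
  simp only [outcomeExpect, LinearMap.sum_apply, LinearMap.smul_apply, LinearMap.comp_apply,
    smul_eq_mul]

theorem outcomeExpect_add {k : ℕ} (f g : (Fin k → J) → R) :
    outcomeExpect Φ τ (f + g) = outcomeExpect Φ τ f + outcomeExpect Φ τ g := by
  simp only [outcomeExpect, Pi.add_apply, add_smul, Finset.sum_add_distrib]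

theorem outcomeExpect_smul {k : ℕ} (c : R) (f : (Fin k → J) → R) :
    outcomeExpect Φ τ (c • f) = c • outcomeExpect Φ τ f := by
  simp only [outcomeExpect, Pi.smul_apply, smul_assoc, Finset.smul_sum]

theorem outcomeExpect_succ_apply {k : ℕ} (f : (Fin (k + 1) → J) → R) (X : V) :
    outcomeExpect Φ τ f X = ∑ j, outcomeExpect Φ τ (fun e => f (Fin.cons j e)) (Φ j X) := by
  simp only [outcomeExpect_apply]
  rw [← (Fin.consEquiv fun _ : Fin (k + 1) => J).sum_comp, Fintype.sum_prod_type]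
  refine Finset.sum_congr rfl fun j _ => Finset.sum_congr rfl fun e _ => ?_
  rw [List.ofFn_succ]
  rfl

theorem outcomeExpect_one (hτ : τ ∘ₗ ∑ j, Φ j = τ) (k : ℕ) :
    outcomeExpect Φ τ (1 : (Fin k → J) → R) = τ := by
  induction k with
  | zero =>
    ext X
    simp only [outcomeExpect_apply, Fintype.sum_unique, Pi.one_apply, one_mul, List.ofFn_zero,
      trajectory, Module.End.one_apply]
  | succ k ih =>
    ext X
    rw [outcomeExpect_succ_apply]
    conv_rhs => rw [← hτ, LinearMap.comp_apply, LinearMap.sum_apply, map_sum]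
    exact Finset.sum_congr rfl fun j _ => LinearMap.congr_fun ih (Φ j X)

theorem outcomeExpect_sum_succ (hτ : τ ∘ₗ ∑ j, Φ j = τ) (y : J → R) (k : ℕ) (X : V) :
    outcomeExpect Φ τ (fun e : Fin (k + 1) → J => ∑ t, y (e t)) X =
      τ (weightedSum Φ y X) +
        outcomeExpect Φ τ (fun e : Fin k → J => ∑ t, y (e t)) ((∑ j, Φ j) X) := by
  have hcons (j : J) : (fun e : Fin k → J => ∑ t, y ((Fin.cons j e : Fin (k + 1) → J) t)) =
      y j • 1 + fun e : Fin k → J => ∑ t, y (e t) := by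
    ext e
    simp only [Fin.sum_univ_succ, Fin.cons_zero, Fin.cons_succ, Pi.add_apply, Pi.smul_apply,
      Pi.one_apply, smul_eq_mul, mul_one]
  rw [outcomeExpect_succ_apply, weightedSum_apply, LinearMap.sum_apply, map_sum, map_sum,
    ← Finset.sum_add_distrib]
  refine Finset.sum_congr rfl fun j _ => ?_
  rw [hcons, outcomeExpect_add, outcomeExpect_smul, outcomeExpect_one hτ, LinearMap.add_apply,
    LinearMap.smul_apply, map_smul]

theorem outcomeExpect_sum_sq_succ (hτ : τ ∘ₗ ∑ j, Φ j = τ) (y : J → R) (k : ℕ) (X : V) :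
    outcomeExpect Φ τ (fun e : Fin (k + 1) → J => (∑ t, y (e t)) ^ 2) X =
      τ (weightedSum Φ (y ^ 2) X) +
        2 * outcomeExpect Φ τ (fun e : Fin k → J => ∑ t, y (e t)) (weightedSum Φ y X) +
        outcomeExpect Φ τ (fun e : Fin k → J => (∑ t, y (e t)) ^ 2) ((∑ j, Φ j) X) := by
  have hcons (j : J) :
      (fun e : Fin k → J => (∑ t, y ((Fin.cons j e : Fin (k + 1) → J) t)) ^ 2) =
        y j ^ 2 • 1 + (2 * y j) • (fun e : Fin k → J => ∑ t, y (e t)) +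
          fun e : Fin k → J => (∑ t, y (e t)) ^ 2 := by
    ext e
    simp only [Fin.sum_univ_succ, Fin.cons_zero, Fin.cons_succ, Pi.add_apply, Pi.smul_apply,
      Pi.one_apply, smul_eq_mul, mul_one, add_sq]
  rw [outcomeExpect_succ_apply, weightedSum_apply, weightedSum_apply, LinearMap.sum_apply, map_sum,
    map_sum, map_sum, Finset.mul_sum, ← Finset.sum_add_distrib, ← Finset.sum_add_distrib]
  refine Finset.sum_congr rfl fun j _ => ?_
  rw [hcons, outcomeExpect_add, outcomeExpect_add, outcomeExpect_smul, outcomeExpect_smul,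
    outcomeExpect_one hτ]
  simp only [LinearMap.add_apply, LinearMap.smul_apply, map_smul, smul_eq_mul, Pi.pow_apply,
    mul_assoc]

theorem outcomeExpect_sum_eq (hτ : τ ∘ₗ ∑ j, Φ j = τ) (y : J → R) (k : ℕ) (X : V) :
    outcomeExpect Φ τ (fun e : Fin k → J => ∑ t, y (e t)) X =
      ∑ t ∈ Finset.range k, τ (weightedSum Φ y (((∑ j, Φ j) ^ t) X)) := by
  induction k generalizing X with
  | zero =>
    simp only [outcomeExpect_apply, Finset.univ_eq_empty, Finset.sum_empty, zero_mul,
      Finset.sum_const_zero, Finset.range_zero]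
  | succ k ih =>
    rw [outcomeExpect_sum_succ hτ, ih, Finset.sum_range_succ', add_comm]
    simp only [pow_succ, Module.End.mul_apply, pow_zero, Module.End.one_apply]

end Trajectory

theorem outcomeExpect_sum_sq_le {V J : Type*} [AddCommGroup V] [Module ℝ V] [Fintype J]
    {Φ : J → Module.End ℝ V} {τ : V →ₗ[ℝ] ℝ} (hτ : τ ∘ₗ ∑ j, Φ j = τ) {ρ : V}
    (hρ : (∑ j, Φ j) ρ = ρ) {y : J → ℝ} {v q : ℝ} (hv0 : 0 ≤ v) (hq0 : 0 ≤ q) (hq1 : q < 1)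
    (hv : τ (weightedSum Φ (y ^ 2) ρ) ≤ v)
    (hcov : ∀ t : ℕ, τ (weightedSum Φ y (((∑ j, Φ j) ^ t) (weightedSum Φ y ρ))) ≤ q ^ (t + 1) * v)
    (k : ℕ) :
    outcomeExpect Φ τ (fun e : Fin k → J => (∑ t, y (e t)) ^ 2) ρ ≤
      k * (v * (1 + 2 * (q / (1 - q)))) := by
  have hgeom (k : ℕ) : ∑ t ∈ Finset.range k, q ^ (t + 1) ≤ q / (1 - q) := by
    simp only [pow_succ']
    rw [← Finset.mul_sum, div_eq_mul_inv, ← tsum_geometric_of_lt_one hq0 hq1]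
    gcongr
    exact (summable_geometric_of_lt_one hq0 hq1).sum_le_tsum _ fun i _ => pow_nonneg hq0 i
  have hcross (k : ℕ) :
      outcomeExpect Φ τ (fun e : Fin k → J => ∑ t, y (e t)) (weightedSum Φ y ρ) ≤
        q / (1 - q) * v := by
    rw [outcomeExpect_sum_eq hτ]
    refine (Finset.sum_le_sum fun t _ => hcov t).trans ?_
    rw [← Finset.sum_mul]
    exact mul_le_mul_of_nonneg_right (hgeom k) hv0
  induction k with
  | zero =>
    simp only [outcomeExpect_apply, Finset.univ_eq_empty, Finset.sum_empty, ne_eq,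
      OfNat.ofNat_ne_zero, not_false_eq_true, zero_pow, zero_mul, Finset.sum_const_zero,
      CharP.cast_eq_zero, le_refl]
  | succ k ih =>
    rw [outcomeExpect_sum_sq_succ hτ, hρ]
    push_cast
    linarith [hcross k]

/-! ### Commuting instruments interleaved with a Gibbs sampler -/

section Expectation

variable {d : ℕ} {ρ F : Op d}

theorem trace_mul_eq_expect (hρ : ρ.IsHermitian) (hF : F.IsHermitian) :
    (F * ρ).trace = expect ρ F := by
  refine (Complex.conj_eq_iff_re.1 ?_).symm
  rw [starRingEnd_apply, ← Matrix.trace_conjTranspose, Matrix.conjTranspose_mul, hρ.eq, hF.eq,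
    Matrix.trace_mul_comm]

theorem rpow_mul_mul_rpow_of_commute (hρ : ρ.PosDef) (hF : Commute ρ F) (s : ℝ) :
    rpow ρ (1 - s) * F * rpow ρ s = ρ * F := by
  rw [mul_assoc, ← (commute_rpow hρ.isHermitian hF s).eq, ← mul_assoc, rpow_mul_rpow hρ,
    sub_add_cancel, rpow_one hρ.isHermitian]

theorem norm_trace_mul_le_weightedNorm (hρ : ρ.PosDef) (hF : F.IsHermitian) (hcomm : Commute ρ F)
    (s : ℝ) (X : Op d) : ‖(F * X).trace‖ ≤ weightedNorm hρ s (ρ * F) * weightedNorm hρ s X := by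
  have h := inner_weightedVec hρ s F X
  rw [rpow_mul_mul_rpow_of_commute hρ hcomm, hF.eq] at h
  rw [← h]
  exact norm_inner_le_norm _ _

theorem weightedNorm_mul_sq (hρ : ρ.PosDef) (hF : F.IsHermitian) (hcomm : Commute ρ F) (s : ℝ) :
    weightedNorm hρ s (ρ * F) ^ 2 = expect ρ (F * F) := by
  have h := inner_weightedVec hρ s F (ρ * F)
  rw [rpow_mul_mul_rpow_of_commute hρ hcomm, hF.eq] at h
  rw [expect, mul_assoc, ← hcomm.eq, ← h]
  exact (inner_self_eq_norm_sq (𝕜 := ℂ) (weightedVec hρ s (ρ * F))).symm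

end Expectation

section Instrument

variable {d : ℕ} {J : Type*}

/-- The trace functional `X ↦ re (tr X)`, which turns unnormalized states into probabilities. -/
def realTrace (d : ℕ) : Op d →ₗ[ℝ] ℝ := Complex.reLm ∘ₗ Matrix.traceLinearMap (Fin d) ℝ ℂ

theorem realTrace_apply (X : Op d) : realTrace d X = X.trace.re := rfl

/-- The branch `X ↦ K j X (K j)†` of the instrument with Kraus operators `K`. -/
def krausBranch (K : J → Op d) (j : J) : Module.End ℝ (Op d) :=
  LinearMap.mulLeftRight ℝ (K j, (K j).conjTranspose)

theorem krausBranch_apply (K : J → Op d) (j : J) (X : Op d) :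
    krausBranch K j X = K j * X * (K j).conjTranspose := rfl

variable [Fintype J]

/-- The instrument with Kraus operators `K`, with the outcome forgotten. -/
def krausChannel (K : J → Op d) : Module.End ℝ (Op d) := ∑ j, krausBranch K j

/-- The observable whose expectation is that of the outcome `y`. -/
def effect (K : J → Op d) (y : J → ℝ) : Op d := ∑ j, y j • ((K j).conjTranspose * K j)

/-- One round with result `j`: the branch `j`, then `r` applications of the sampler, then the whole
instrument with the result forgotten. -/
def roundMap (K : J → Op d) (N : SuperOp d) (r : ℕ) (j : J) : Module.End ℝ (Op d) :=
  krausChannel K * (N ^ r).restrictScalars ℝ * krausBranch K j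

/-- Kraus operators of an instrument that are normal and commute with `ρ`. -/
structure IsCommutingInstrument (ρ : Op d) (K : J → Op d) : Prop where
  sum_eq_one : ∑ j, (K j).conjTranspose * K j = 1
  normal : ∀ j, Commute (K j) (K j).conjTranspose
  commute_state : ∀ j, Commute ρ (K j)

theorem krausChannel_apply (K : J → Op d) (X : Op d) :
    krausChannel K X = ∑ j, K j * X * (K j).conjTranspose := by
  simp only [krausChannel, LinearMap.sum_apply, krausBranch_apply]

theorem effect_isHermitian (K : J → Op d) (y : J → ℝ) : (effect K y).IsHermitian :=
  Matrix.isHermitian_iff_isSelfAdjoint.2 <| isSelfAdjoint_sum _ fun j _ =>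
    (IsSelfAdjoint.all (y j)).smul (IsSelfAdjoint.star_mul_self (K j))

theorem trace_weightedSum_krausBranch (K : J → Op d) (y : J → ℝ) (X : Op d) :
    (weightedSum (krausBranch K) y X).trace = (effect K y * X).trace := by
  simp only [weightedSum_apply, effect, Matrix.sum_mul, Matrix.trace_sum, krausBranch_apply,
    smul_mul_assoc, Matrix.trace_smul, fun j => Matrix.trace_mul_cycle (K j) X (K j).conjTranspose]

theorem weightedSum_roundMap (K : J → Op d) (N : SuperOp d) (r : ℕ) (y : J → ℝ) :
    weightedSum (roundMap K N r) y =
      krausChannel K * (N ^ r).restrictScalars ℝ * weightedSum (krausBranch K) y := by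
  simp only [weightedSum, roundMap, Finset.mul_sum, mul_smul_comm]

theorem sum_roundMap (K : J → Op d) (N : SuperOp d) (r : ℕ) :
    ∑ j, roundMap K N r j = krausChannel K * (N ^ r).restrictScalars ℝ * krausChannel K :=
  (Finset.mul_sum _ _ _).symm

variable {ρ : Op d} {K : J → Op d} {s : ℝ} {N : SuperOp d}

theorem trace_krausChannel (hK : ∑ j, (K j).conjTranspose * K j = 1) (X : Op d) :
    (krausChannel K X).trace = X.trace := by
  simp only [krausChannel_apply, Matrix.trace_sum,
    fun j => Matrix.trace_mul_cycle (K j) X (K j).conjTranspose]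
  rw [← Matrix.trace_sum, ← Matrix.sum_mul, hK, one_mul]

theorem trace_weightedSum_roundMap (hK : ∑ j, (K j).conjTranspose * K j = 1) (hN : IsChannel N)
    (r : ℕ) (y : J → ℝ) (X : Op d) :
    (weightedSum (roundMap K N r) y X).trace = (effect K y * X).trace := by
  rw [weightedSum_roundMap, Module.End.mul_apply, Module.End.mul_apply, trace_krausChannel hK,
    LinearMap.restrictScalars_apply, hN.trace_pow_apply, trace_weightedSum_krausBranch]

theorem trace_sum_roundMap (hK : ∑ j, (K j).conjTranspose * K j = 1) (hN : IsChannel N) (r : ℕ)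
    (X : Op d) : ((∑ j, roundMap K N r j) X).trace = X.trace := by
  rw [sum_roundMap, Module.End.mul_apply, Module.End.mul_apply, trace_krausChannel hK,
    LinearMap.restrictScalars_apply, hN.trace_pow_apply, trace_krausChannel hK]

theorem realTrace_comp_sum_roundMap (hK : ∑ j, (K j).conjTranspose * K j = 1) (hN : IsChannel N)
    (r : ℕ) : realTrace d ∘ₗ ∑ j, roundMap K N r j = realTrace d :=
  LinearMap.ext fun X => congrArg Complex.re (trace_sum_roundMap hK hN r X)

theorem effect_sub_const (hK : ∑ j, (K j).conjTranspose * K j = 1) (y : J → ℝ) (μ : ℝ) :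
    effect K (fun j => y j - μ) = effect K y - μ • (1 : Op d) := by
  simp only [effect, sub_smul, Finset.sum_sub_distrib, ← Finset.smul_sum, hK]

theorem expect_effect_sub_const (hK : ∑ j, (K j).conjTranspose * K j = 1) (hρ1 : ρ.trace = 1)
    (y : J → ℝ) (μ : ℝ) : expect ρ (effect K fun j => y j - μ) = expect ρ (effect K y) - μ := by
  rw [effect_sub_const hK, expect, sub_mul, smul_mul_assoc, one_mul, Matrix.trace_sub,
    Matrix.trace_smul, hρ1, Complex.sub_re, Complex.real_smul, mul_one, Complex.ofReal_re, expect]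

theorem sum_sub_effect_mul_mul_sub_effect (hK : ∑ j, (K j).conjTranspose * K j = 1)
    (y : J → ℝ) :
    ∑ j, (y j • 1 - effect K y) * ((K j).conjTranspose * K j) * (y j • 1 - effect K y) =
      effect K (y ^ 2) - effect K y * effect K y := by
  set F := effect K y with hF
  have hexpand (j : J) :
      (y j • 1 - F) * ((K j).conjTranspose * K j) * (y j • 1 - F) =
        (y ^ 2) j • ((K j).conjTranspose * K j) - F * (y j • ((K j).conjTranspose * K j)) -
          (y j • ((K j).conjTranspose * K j)) * F + F * ((K j).conjTranspose * K j) * F := by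
    simp only [sub_mul, mul_sub, smul_mul_assoc, mul_smul_comm, one_mul, mul_one, smul_smul,
      smul_sub, Pi.pow_apply, pow_two]
    abel
  simp only [hexpand, Finset.sum_add_distrib, Finset.sum_sub_distrib, ← Finset.mul_sum,
    ← Finset.sum_mul, hK, mul_one]
  rw [← effect, ← effect, ← hF]
  abel

theorem expect_effect_mul_self_le (hK : ∑ j, (K j).conjTranspose * K j = 1)
    (hρ : ρ.PosSemidef) (y : J → ℝ) :
    expect ρ (effect K y * effect K y) ≤ expect ρ (effect K (y ^ 2)) := by
  rw [← sub_nonneg, expect, expect, ← Complex.sub_re, ← Matrix.trace_sub, ← sub_mul,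
    ← sum_sub_effect_mul_mul_sub_effect hK, Matrix.sum_mul, Matrix.trace_sum, Complex.re_sum]
  refine Finset.sum_nonneg fun j _ => ?_
  set G := y j • (1 : Op d) - effect K y with hG
  have hGH : G.conjTranspose = G := by
    rw [hG, Matrix.conjTranspose_sub, Matrix.conjTranspose_smul, (effect_isHermitian K y).eq,
      Matrix.conjTranspose_one, star_trivial]
  have hpos := (hρ.mul_mul_conjTranspose_same (K j * G)).trace_nonneg
  rw [Matrix.conjTranspose_mul, hGH, Matrix.trace_mul_comm] at hpos
  simpa only [mul_assoc] using (Complex.nonneg_iff.1 hpos).1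

namespace IsCommutingInstrument

theorem commute_state_conjTranspose (hK : IsCommutingInstrument ρ K) (hρ : ρ.IsHermitian) (j : J) :
    Commute ρ (K j).conjTranspose := by
  have h := (hK.commute_state j).star_star
  rwa [Matrix.star_eq_conjTranspose, hρ.eq] at h

theorem sum_mul_conjTranspose (hK : IsCommutingInstrument ρ K) :
    ∑ j, K j * (K j).conjTranspose = 1 := by
  simp only [fun j => (hK.normal j).eq, hK.sum_eq_one]

theorem commute_state_effect (hK : IsCommutingInstrument ρ K) (hρ : ρ.IsHermitian) (y : J → ℝ) :
    Commute ρ (effect K y) :=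
  Commute.sum_right _ _ _ fun j _ =>
    ((hK.commute_state_conjTranspose hρ j).mul_right (hK.commute_state j)).smul_right _

theorem weightedSum_krausBranch_state (hK : IsCommutingInstrument ρ K) (y : J → ℝ) :
    weightedSum (krausBranch K) y ρ = ρ * effect K y := by
  simp only [weightedSum_apply, krausBranch_apply, effect, Finset.mul_sum, mul_smul_comm,
    ← fun j => (hK.commute_state j).eq, mul_assoc, fun j => (hK.normal j).eq]

theorem krausChannel_state (hK : IsCommutingInstrument ρ K) : krausChannel K ρ = ρ := by
  simp only [krausChannel_apply, ← fun j => (hK.commute_state j).eq, mul_assoc]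
  rw [← Finset.mul_sum, hK.sum_mul_conjTranspose, mul_one]

theorem weightedNorm_krausChannel_le (hK : IsCommutingInstrument ρ K) (hρ : ρ.PosDef) (s : ℝ)
    (X : Op d) : weightedNorm hρ s (krausChannel K X) ≤ weightedNorm hρ s X := by
  set a := rpow ρ (-((1 - s) / 2))
  set b := rpow ρ (-(s / 2))
  have ha (j : J) : a * K j = K j * a :=
    commute_rpow hρ.isHermitian (hK.commute_state j) _
  have hb (j : J) : b * (K j).conjTranspose = (K j).conjTranspose * b :=
    commute_rpow hρ.isHermitian (hK.commute_state_conjTranspose hρ.isHermitian j) _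
  have hconj : a * krausChannel K X * b = ∑ j, K j * (a * X * b) * (K j).conjTranspose := by
    rw [krausChannel_apply, Finset.mul_sum, Finset.sum_mul]
    refine Finset.sum_congr rfl fun j _ => ?_
    calc a * (K j * X * (K j).conjTranspose) * b
        = (a * K j) * X * ((K j).conjTranspose * b) := by simp only [mul_assoc]
      _ = K j * (a * X * b) * (K j).conjTranspose := by
          rw [ha, ← hb]
          simp only [mul_assoc]
  have h := hsNorm_sum_mul_mul_conjTranspose_le hK.sum_eq_one hK.sum_mul_conjTranspose (a * X * b)
  rwa [← hconj] at h

theorem sum_roundMap_state (hK : IsCommutingInstrument ρ K) (hN : IsGibbsSampler ρ s N) (r : ℕ) :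
    (∑ j, roundMap K N r j) ρ = ρ := by
  rw [sum_roundMap, Module.End.mul_apply, Module.End.mul_apply, hK.krausChannel_state,
    LinearMap.restrictScalars_apply, hN.pow_fixed, hK.krausChannel_state]

theorem weightedNorm_sum_roundMap_le (hK : IsCommutingInstrument ρ K)
    (hN : IsGibbsSampler ρ s N) (hρ : ρ.PosDef) (r : ℕ) {X : Op d} (hX : X.trace = 0) :
    weightedNorm hρ s ((∑ j, roundMap K N r j) X) ≤ (1 - gap N) ^ r * weightedNorm hρ s X := by
  have hq : 0 ≤ (1 - gap N) ^ r := pow_nonneg (sub_nonneg.2 hN.gap_le_one) _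
  rw [sum_roundMap]
  calc _ ≤ weightedNorm hρ s ((N ^ r) (krausChannel K X)) := hK.weightedNorm_krausChannel_le hρ s _
    _ ≤ (1 - gap N) ^ r * weightedNorm hρ s (krausChannel K X) :=
        hN.weightedNorm_pow_apply_le hρ ((trace_krausChannel hK.sum_eq_one X).trans hX) r
    _ ≤ (1 - gap N) ^ r * weightedNorm hρ s X := by
        gcongr
        exact hK.weightedNorm_krausChannel_le hρ s X

theorem weightedNorm_sum_roundMap_pow_le (hK : IsCommutingInstrument ρ K)
    (hN : IsGibbsSampler ρ s N) (hρ : ρ.PosDef) (r t : ℕ) {X : Op d} (hX : X.trace = 0) :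
    weightedNorm hρ s (((∑ j, roundMap K N r j) ^ t) X) ≤
      ((1 - gap N) ^ r) ^ t * weightedNorm hρ s X := by
  have hq : 0 ≤ (1 - gap N) ^ r := pow_nonneg (sub_nonneg.2 hN.gap_le_one) _
  induction t generalizing X with
  | zero => rw [pow_zero, pow_zero, one_mul, Module.End.one_apply]
  | succ t ih =>
    rw [pow_succ, Module.End.mul_apply, pow_succ _ t, mul_assoc]
    refine (ih ((trace_sum_roundMap hK.sum_eq_one hN.channel r X).trans hX)).trans ?_
    gcongr
    exact hK.weightedNorm_sum_roundMap_le hN hρ r hX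

theorem realTrace_autocorrelation_le (hK : IsCommutingInstrument ρ K) (hN : IsGibbsSampler ρ s N)
    (hρ : ρ.PosDef) (r t : ℕ) {y : J → ℝ} (hy : expect ρ (effect K y) = 0) :
    realTrace d (weightedSum (roundMap K N r) y (((∑ j, roundMap K N r j) ^ t)
      (weightedSum (roundMap K N r) y ρ))) ≤
      ((1 - gap N) ^ r) ^ (t + 1) * expect ρ (effect K (y ^ 2)) := by
  have hq : 0 ≤ (1 - gap N) ^ r := pow_nonneg (sub_nonneg.2 hN.gap_le_one) _
  have hF := effect_isHermitian K y
  have hcomm := hK.commute_state_effect hρ.isHermitian y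
  set w := weightedNorm hρ s (ρ * effect K y)
  have hw0 : 0 ≤ w := weightedNorm_nonneg hρ s _
  set X := weightedSum (roundMap K N r) y ρ with hX
  have hcentred : (effect K y * ρ).trace = 0 := by
    rw [trace_mul_eq_expect hρ.isHermitian hF, hy, Complex.ofReal_zero]
  have hX0 : X.trace = 0 := by
    rw [hX, trace_weightedSum_roundMap hK.sum_eq_one hN.channel, hcentred]
  have hXw : weightedNorm hρ s X ≤ (1 - gap N) ^ r * w := by
    rw [hX, weightedSum_roundMap, Module.End.mul_apply, Module.End.mul_apply,
      hK.weightedSum_krausBranch_state]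
    refine (hK.weightedNorm_krausChannel_le hρ s _).trans
      (hN.weightedNorm_pow_apply_le hρ ?_ r)
    rw [Matrix.trace_mul_comm, hcentred]
  rw [realTrace_apply, trace_weightedSum_roundMap hK.sum_eq_one hN.channel]
  calc _ ≤ ‖(effect K y * ((∑ j, roundMap K N r j) ^ t) X).trace‖ := Complex.re_le_norm _
    _ ≤ w * weightedNorm hρ s (((∑ j, roundMap K N r j) ^ t) X) :=
        norm_trace_mul_le_weightedNorm hρ hF hcomm s _
    _ ≤ w * (((1 - gap N) ^ r) ^ t * ((1 - gap N) ^ r * w)) := by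
        gcongr
        refine (hK.weightedNorm_sum_roundMap_pow_le hN hρ r t hX0).trans ?_
        gcongr
    _ = ((1 - gap N) ^ r) ^ (t + 1) * expect ρ (effect K y * effect K y) := by
        rw [← weightedNorm_mul_sq hρ hF hcomm s]
        ring
    _ ≤ ((1 - gap N) ^ r) ^ (t + 1) * expect ρ (effect K (y ^ 2)) := by
        gcongr
        exact expect_effect_mul_self_le hK.sum_eq_one hρ.posSemidef y

theorem outcomeExpect_roundMap_sum_sq_le (hK : IsCommutingInstrument ρ K)
    (hN : IsGibbsSampler ρ s N) (hρ : ρ.PosDef) {q : ℝ} {r : ℕ} (hq : (1 - gap N) ^ r ≤ q)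
    (hq1 : q < 1) {y : J → ℝ} (hy : expect ρ (effect K y) = 0) {v : ℝ}
    (hv : expect ρ (effect K (y ^ 2)) ≤ v) (k : ℕ) :
    outcomeExpect (roundMap K N r) (realTrace d) (fun e : Fin k → J => (∑ t, y (e t)) ^ 2) ρ ≤
      k * (v * (1 + 2 * (q / (1 - q)))) := by
  have hgap : 0 ≤ (1 - gap N) ^ r := pow_nonneg (sub_nonneg.2 hN.gap_le_one) _
  have hvar : 0 ≤ expect ρ (effect K (y ^ 2)) := by
    refine le_trans ?_ (expect_effect_mul_self_le hK.sum_eq_one hρ.posSemidef y)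
    rw [← weightedNorm_mul_sq hρ (effect_isHermitian K y)
      (hK.commute_state_effect hρ.isHermitian y) s]
    exact sq_nonneg _
  refine outcomeExpect_sum_sq_le
    (realTrace_comp_sum_roundMap hK.sum_eq_one hN.channel r) (hK.sum_roundMap_state hN r)
    (hvar.trans hv) (hgap.trans hq) hq1 ?_ (fun t => ?_) k
  · rwa [realTrace_apply, trace_weightedSum_roundMap hK.sum_eq_one hN.channel]
  · refine (hK.realTrace_autocorrelation_le hN hρ r t hy).trans ?_
    have := hgap.trans hq
    gcongr

end IsCommutingInstrument

end Instrument

/-! ### Success probability of a protocol -/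

section Positivity

variable {d : ℕ} {J : Type*} [Fintype J] {K : J → Op d} {N : SuperOp d}

theorem posSemidef_roundMap_apply (hN : IsChannel N) (r : ℕ) (j : J) {X : Op d}
    (hX : X.PosSemidef) : (roundMap K N r j X).PosSemidef := by
  simp only [roundMap, Module.End.mul_apply, krausChannel_apply, krausBranch_apply]
  exact Matrix.posSemidef_sum _ fun i _ =>
    (hN.posSemidef_pow_apply r (hX.mul_mul_conjTranspose_same _)).mul_mul_conjTranspose_same _

theorem realTrace_trajectory_nonneg (hN : IsChannel N) (r : ℕ) (l : List J) {X : Op d}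
    (hX : X.PosSemidef) : 0 ≤ realTrace d (trajectory (roundMap K N r) l X) := by
  induction l generalizing X with
  | nil => exact (Complex.nonneg_iff.1 hX.trace_nonneg).1
  | cons j _ ih => exact ih (posSemidef_roundMap_apply hN r j hX)

theorem outcomeExpect_roundMap_mono (hN : IsChannel N) (r : ℕ) {k : ℕ} {f g : (Fin k → J) → ℝ}
    (hfg : f ≤ g) {X : Op d} (hX : X.PosSemidef) :
    outcomeExpect (roundMap K N r) (realTrace d) f X ≤
      outcomeExpect (roundMap K N r) (realTrace d) g X := by
  simp only [outcomeExpect_apply]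
  exact Finset.sum_le_sum fun e _ =>
    mul_le_mul_of_nonneg_right (hfg e) (realTrace_trajectory_nonneg hN r _ hX)

theorem outcomeExpect_roundMap_one (hK : ∑ j, (K j).conjTranspose * K j = 1) (hN : IsChannel N)
    (r k : ℕ) {σ : Op d} (hσ : σ.trace = 1) :
    outcomeExpect (roundMap K N r) (realTrace d) (1 : (Fin k → J) → ℝ) σ = 1 := by
  rw [outcomeExpect_one (realTrace_comp_sum_roundMap hK hN r), realTrace_apply, hσ, Complex.one_re]

theorem outcomeExpect_roundMap_mem_Icc (hK : ∑ j, (K j).conjTranspose * K j = 1)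
    (hN : IsChannel N) (r : ℕ) {k : ℕ} {f : (Fin k → J) → ℝ} (hf0 : 0 ≤ f) (hf1 : f ≤ 1)
    {σ : Op d} (hσ : IsState σ) :
    outcomeExpect (roundMap K N r) (realTrace d) f σ ∈ Set.Icc 0 1 := by
  refine ⟨?_, ?_⟩
  · rw [outcomeExpect_apply]
    exact Finset.sum_nonneg fun e _ =>
      mul_nonneg (hf0 e) (realTrace_trajectory_nonneg hN r _ hσ.1)
  · exact (outcomeExpect_roundMap_mono hN r hf1 hσ.1).trans_eq
      (outcomeExpect_roundMap_one hK hN r k hσ.2)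

end Positivity

namespace Protocol

variable {d : ℕ} {ρ O : Op d} {N : SuperOp d} {s : ℝ}

theorem run_eq_trajectory (P : Protocol) (O : Op d) (N : SuperOp d)
    (l : List (Fin (2 ^ P.meas.ancillas))) (X : Op d) :
    P.run O N l X = trajectory (roundMap (P.meas.kraus O) N P.spacing) l X := by
  induction l generalizing X with
  | nil => rfl
  | cons j l ih =>
    rw [run, ih, trajectory, Module.End.mul_apply]
    simp only [round, Measurement.channel, Measurement.branch, roundMap, Module.End.mul_apply,
      krausChannel_apply, krausBranch_apply, LinearMap.restrictScalars_apply]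

theorem prob_nonneg (P : Protocol) (hN : IsChannel N) {σ : Op d} (hσ : σ.PosSemidef)
    (e : Fin P.rounds → Fin (2 ^ P.meas.ancillas)) : 0 ≤ P.prob O N σ e := by
  rw [prob, run_eq_trajectory]
  exact realTrace_trajectory_nonneg hN _ _ (hN.posSemidef_pow_apply _ hσ)

theorem successProb_nonneg (P : Protocol) (hN : IsChannel N) {σ : Op d} (hσ : σ.PosSemidef)
    (v ε : ℝ) : 0 ≤ P.successProb O N σ v ε :=
  Finset.sum_nonneg fun e _ => P.prob_nonneg hN hσ e

/-- The indicator function of the event that the output is within `ε` of `v`. -/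
def successIndicator (P : Protocol) (v ε : ℝ) :
    (Fin P.rounds → Fin (2 ^ P.meas.ancillas)) → ℝ :=
  {e | |P.output e - v| < ε}.indicator 1

theorem successProb_eq_outcomeExpect (P : Protocol) (O : Op d) (N : SuperOp d) (σ : Op d)
    (v ε : ℝ) :
    P.successProb O N σ v ε = outcomeExpect (roundMap (P.meas.kraus O) N P.spacing) (realTrace d)
      (P.successIndicator v ε) ((N ^ P.burnIn) σ) := by
  rw [successProb, outcomeExpect_apply, Finset.sum_filter]
  refine Finset.sum_congr rfl fun e _ => ?_
  rw [successIndicator, Set.indicator_apply, ite_mul, Pi.one_apply, one_mul, zero_mul, prob,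
    run_eq_trajectory]
  rfl

theorem one_sub_sq_div_sq_le_successIndicator (P : Protocol) {μ v ε : ℝ} (hε : 0 < ε)
    (hbias : |μ - v| ≤ ε / 2) (hrounds : 0 < P.rounds)
    (e : Fin P.rounds → Fin (2 ^ P.meas.ancillas)) :
    1 - (∑ t, (P.meas.readout (e t) - μ)) ^ 2 / (P.rounds * (ε / 2)) ^ 2 ≤
      P.successIndicator v ε e := by
  have hpos : (0 : ℝ) < P.rounds := Nat.cast_pos.2 hrounds
  have hsum : ∑ t, (P.meas.readout (e t) - μ) = P.rounds * (P.output e - μ) := by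
    rw [Finset.sum_sub_distrib, output, mul_sub, mul_div_cancel₀ _ hpos.ne', Finset.sum_const,
      Finset.card_univ, Fintype.card_fin, nsmul_eq_mul]
  rw [hsum, mul_pow, mul_pow, mul_div_mul_left _ _ (by positivity)]
  by_cases he : |P.output e - v| < ε
  · have hmem : e ∈ {e | |P.output e - v| < ε} := he
    rw [successIndicator, Set.indicator_of_mem hmem, Pi.one_apply]
    exact sub_le_self 1 (by positivity)
  · have hmem : e ∉ {e | |P.output e - v| < ε} := he
    rw [successIndicator, Set.indicator_of_notMem hmem, sub_nonpos, one_le_div₀ (by positivity),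
      ← sq_abs (P.output e - μ)]
    gcongr
    linarith [abs_sub_le (P.output e) μ v]

theorem one_sub_le_outcomeExpect_successIndicator (P : Protocol)
    (hK : IsCommutingInstrument ρ (P.meas.kraus O)) (hN : IsGibbsSampler ρ s N) (hρ : ρ.PosDef)
    (hρ1 : ρ.trace = 1) {η ε q μ v o : ℝ} (hq : (1 - gap N) ^ P.spacing ≤ q) (hq1 : q < 1)
    (hε : 0 < ε) (hμ : expect ρ (effect (P.meas.kraus O) P.meas.readout) = μ)
    (hbias : |μ - o| ≤ ε / 2)
    (hv : expect ρ (effect (P.meas.kraus O) fun j => (P.meas.readout j - μ) ^ 2) ≤ v)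
    (hrounds : 0 < P.rounds)
    (hcheb : v * (1 + 2 * (q / (1 - q))) ≤ η * (P.rounds * (ε / 2) ^ 2)) :
    1 - η ≤ outcomeExpect (roundMap (P.meas.kraus O) N P.spacing) (realTrace d)
      (P.successIndicator o ε) ρ := by
  set E := outcomeExpect (k := P.rounds) (roundMap (P.meas.kraus O) N P.spacing) (realTrace d)
  set z : Fin (2 ^ P.meas.ancillas) → ℝ := fun j => P.meas.readout j - μ
  set δ : ℝ := P.rounds * (ε / 2)
  have hδ : 0 < δ := mul_pos (Nat.cast_pos.2 hrounds) (half_pos hε)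
  have hcentred : expect ρ (effect (P.meas.kraus O) z) = 0 := by
    rw [expect_effect_sub_const hK.sum_eq_one hρ1, hμ, sub_self]
  have hsecond : E (fun e => (∑ t, z (e t)) ^ 2) ρ ≤ η * δ ^ 2 :=
    calc _ ≤ P.rounds * (v * (1 + 2 * (q / (1 - q)))) :=
          hK.outcomeExpect_roundMap_sum_sq_le hN hρ hq hq1 hcentred hv P.rounds
      _ ≤ P.rounds * (η * (P.rounds * (ε / 2) ^ 2)) := by gcongr
      _ = η * δ ^ 2 := by ring
  calc 1 - η ≤ 1 + -(δ ^ 2)⁻¹ * E (fun e => (∑ t, z (e t)) ^ 2) ρ := by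
        rw [neg_mul, ← sub_eq_add_neg, inv_mul_eq_div]
        gcongr
        rwa [div_le_iff₀ (by positivity)]
    _ = E (1 + (-(δ ^ 2)⁻¹) • fun e => (∑ t, z (e t)) ^ 2) ρ := by
        simp only [E]
        rw [outcomeExpect_add, outcomeExpect_smul, LinearMap.add_apply, LinearMap.smul_apply,
          outcomeExpect_roundMap_one hK.sum_eq_one hN.channel _ _ hρ1, smul_eq_mul]
    _ ≤ E (P.successIndicator o ε) ρ := by
        refine outcomeExpect_roundMap_mono hN.channel _ (fun e => ?_) hρ.posSemidef
        refine le_trans (le_of_eq ?_) (P.one_sub_sq_div_sq_le_successIndicator hε hbias hrounds e)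
        simp only [Pi.add_apply, Pi.one_apply, Pi.smul_apply, smul_eq_mul, z, δ]
        ring

theorem one_sub_le_successProb (P : Protocol)
    (hK : IsCommutingInstrument ρ (P.meas.kraus O)) (hN : IsGibbsSampler ρ s N) (hρ : ρ.PosDef)
    (hρ1 : ρ.trace = 1) {η ε q μ v o : ℝ} (hgap : 0 < gap N) (hη : 0 < η)
    (hT : mixingTime ρ N η ≤ P.burnIn) (hq : (1 - gap N) ^ P.spacing ≤ q) (hq1 : q < 1)
    (hε : 0 < ε) (hμ : expect ρ (effect (P.meas.kraus O) P.meas.readout) = μ)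
    (hbias : |μ - o| ≤ ε / 2)
    (hv : expect ρ (effect (P.meas.kraus O) fun j => (P.meas.readout j - μ) ^ 2) ≤ v)
    (hrounds : 0 < P.rounds)
    (hcheb : v * (1 + 2 * (q / (1 - q))) ≤ η * (P.rounds * (ε / 2) ^ 2)) {σ : Op d}
    (hσ : IsState σ) : 1 - 2 * η ≤ P.successProb O N σ o ε := by
  set g := outcomeExpect (roundMap (P.meas.kraus O) N P.spacing) (realTrace d)
    (P.successIndicator o ε)
  have hstationary : 1 - η ≤ g ρ := P.one_sub_le_outcomeExpect_successIndicator hK hN hρ hρ1 hq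
    hq1 hε hμ hbias hv hrounds hcheb
  have hg (σ : Op d) (hσ : IsState σ) : g σ ∈ Set.Icc 0 1 :=
    outcomeExpect_roundMap_mem_Icc hK.sum_eq_one hN.channel _
      (Set.indicator_nonneg fun _ _ => zero_le_one)
      (Set.indicator_le_self' fun _ _ => zero_le_one) hσ
  have hmixed : |g ((N ^ P.burnIn) σ - ρ)| ≤ η :=
    (abs_le_traceNorm g hg ((hN.channel.isState_pow_apply _ hσ).1.isHermitian.sub
      hρ.isHermitian)).trans (hN.traceNorm_pow_sub_le hρ hρ1 hgap hη hT hσ)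
  rw [map_sub] at hmixed
  rw [successProb_eq_outcomeExpect]
  linarith [(abs_le.1 hmixed).1]

end Protocol

/-! ### Spectral distribution of an observable -/

section Spectral

variable {d : ℕ} {O ρ : Op d}

/-- The operator with the eigenvectors of `O` and the eigenvalues `f`, where `f` is indexed like
`hO.eigenvalues`. -/
def spectralMap (hO : O.IsHermitian) : (Fin d → ℂ) →⋆ₐ[ℂ] Op d :=
  (Unitary.conjStarAlgAut ℂ (Op d) hO.eigenvectorUnitary : Op d →⋆ₐ[ℂ] Op d).comp
    { Matrix.diagonalAlgHom ℂ with map_star' := fun f => (Matrix.diagonal_conjTranspose f).symm }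

theorem spectralMap_apply (hO : O.IsHermitian) (f : Fin d → ℂ) :
    spectralMap hO f =
      hO.eigenvectorUnitary * Matrix.diagonal f * star (hO.eigenvectorUnitary : Op d) := rfl

theorem spectralMap_eigenvalues (hO : O.IsHermitian) :
    spectralMap hO (fun a => (hO.eigenvalues a : ℂ)) = O := hO.spectral_theorem.symm

theorem exp_smul_eq_spectralMap (hO : O.IsHermitian) (c : ℂ) :
    NormedSpace.exp (c • O) = spectralMap hO fun a => Complex.exp (c * hO.eigenvalues a) := by
  let _ : NormedRing (Op d) := Matrix.linftyOpNormedRing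
  let _ : NormedAlgebra ℂ (Op d) := Matrix.linftyOpNormedAlgebra
  have hcont : Continuous (spectralMap hO) :=
    (spectralMap hO).toAlgHom.toLinearMap.continuous_of_finiteDimensional
  calc NormedSpace.exp (c • O)
      = NormedSpace.exp (spectralMap hO (c • fun a => (hO.eigenvalues a : ℂ))) := by
        rw [map_smul, spectralMap_eigenvalues]
    _ = spectralMap hO (NormedSpace.exp (c • fun a => (hO.eigenvalues a : ℂ))) :=
        (NormedSpace.map_exp (spectralMap hO) hcont _).symm
    _ = spectralMap hO fun a => Complex.exp (c * hO.eigenvalues a) := by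
        congr 1
        ext a
        rw [Pi.coe_exp, Complex.exp_eq_exp_ℂ, Pi.smul_apply, smul_eq_mul]

/-- The distribution of the observable `O` in the state `ρ`, over the eigenvectors of `O`. -/
def spectralWeight (hO : O.IsHermitian) (ρ : Op d) (a : Fin d) : ℝ :=
  ((star (hO.eigenvectorUnitary : Op d) * ρ * hO.eigenvectorUnitary) a a).re

theorem spectralWeight_nonneg (hO : O.IsHermitian) (hρ : ρ.PosSemidef) (a : Fin d) :
    0 ≤ spectralWeight hO ρ a :=
  (Complex.nonneg_iff.1 (hρ.conjTranspose_mul_mul_same _).diag_nonneg).1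

theorem expect_spectralMap (hO : O.IsHermitian) (ρ : Op d) (f : Fin d → ℝ) :
    expect ρ (spectralMap hO fun a => (f a : ℂ)) = ∑ a, spectralWeight hO ρ a * f a := by
  have htrace : (spectralMap hO (fun a => (f a : ℂ)) * ρ).trace =
      ((star (hO.eigenvectorUnitary : Op d) * ρ * hO.eigenvectorUnitary) *
        Matrix.diagonal fun a => (f a : ℂ)).trace := by
    rw [spectralMap_apply, mul_assoc, mul_assoc, Matrix.trace_mul_comm, mul_assoc,
      Matrix.trace_mul_comm]
  rw [expect, htrace, Matrix.trace, Complex.re_sum]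
  refine Finset.sum_congr rfl fun a _ => ?_
  rw [Matrix.diag_apply, Matrix.mul_diagonal, Complex.re_mul_ofReal, spectralWeight]

theorem expect_eq_sum (hO : O.IsHermitian) (ρ : Op d) :
    expect ρ O = ∑ a, spectralWeight hO ρ a * hO.eigenvalues a := by
  rw [← expect_spectralMap, spectralMap_eigenvalues]

theorem expect_mul_self_eq_sum (hO : O.IsHermitian) (ρ : Op d) :
    expect ρ (O * O) = ∑ a, spectralWeight hO ρ a * hO.eigenvalues a ^ 2 := by
  have hsq : (fun a => ((hO.eigenvalues a ^ 2 : ℝ) : ℂ)) =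
      (fun a => (hO.eigenvalues a : ℂ)) * fun a => (hO.eigenvalues a : ℂ) := by
    ext a
    rw [Complex.ofReal_pow, pow_two, Pi.mul_apply]
  rw [← expect_spectralMap, hsq, map_mul, spectralMap_eigenvalues]

theorem sum_spectralWeight (hO : O.IsHermitian) (hρ1 : ρ.trace = 1) :
    ∑ a, spectralWeight hO ρ a = 1 := by
  have h := expect_spectralMap hO ρ fun _ => 1
  simp only [Complex.ofReal_one, mul_one] at h
  rw [← h, ← Pi.one_def, map_one, expect, one_mul, hρ1, Complex.one_re]

theorem sum_spectralWeight_mul_sub_sq (hO : O.IsHermitian) (hρ1 : ρ.trace = 1) (μ : ℝ) :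
    ∑ a, spectralWeight hO ρ a * (hO.eigenvalues a - μ) ^ 2 =
      variance ρ O + (expect ρ O - μ) ^ 2 := by
  have hexpand (a : Fin d) : spectralWeight hO ρ a * (hO.eigenvalues a - μ) ^ 2 =
      spectralWeight hO ρ a * hO.eigenvalues a ^ 2 -
        2 * μ * (spectralWeight hO ρ a * hO.eigenvalues a) + spectralWeight hO ρ a * μ ^ 2 := by
    ring
  simp only [hexpand, Finset.sum_add_distrib, Finset.sum_sub_distrib]
  rw [← Finset.mul_sum, ← Finset.sum_mul, sum_spectralWeight hO hρ1, ← expect_eq_sum,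
    ← expect_mul_self_eq_sum, variance]
  ring

theorem variance_nonneg (hO : O.IsHermitian) (hρ : ρ.PosSemidef) (hρ1 : ρ.trace = 1) :
    0 ≤ variance ρ O := by
  have h := sum_spectralWeight_mul_sub_sq hO hρ1 (expect ρ O)
  rw [sub_self, zero_pow two_ne_zero, add_zero] at h
  rw [← h]
  exact Finset.sum_nonneg fun a _ => mul_nonneg (spectralWeight_nonneg hO hρ a) (sq_nonneg _)

theorem abs_eigenvalues_le_opNorm (hO : O.IsHermitian) (a : Fin d) :
    |hO.eigenvalues a| ≤ opNorm O := by
  have heigen : Matrix.toEuclideanCLM (𝕜 := ℂ) O (hO.eigenvectorBasis a) =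
      (hO.eigenvalues a : ℂ) • hO.eigenvectorBasis a := by
    ext i
    exact congrFun (hO.mulVec_eigenvectorBasis a) i
  have hle := (Matrix.toEuclideanCLM (𝕜 := ℂ) O).le_opNorm (hO.eigenvectorBasis a)
  rwa [heigen, norm_smul, hO.eigenvectorBasis.norm_eq_one, mul_one, mul_one, Complex.norm_real,
    Real.norm_eq_abs] at hle

end Spectral

section UnitaryVectors

variable {ι : Type*} [Fintype ι]

theorem star_dotProduct_self (u : ι → ℂ) : star u ⬝ᵥ u = ((∑ i, ‖u i‖ ^ 2 : ℝ) : ℂ) := by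
  rw [dotProduct, Complex.ofReal_sum]
  refine Finset.sum_congr rfl fun i _ => ?_
  rw [Pi.star_apply, RCLike.star_def, Complex.conj_mul', Complex.ofReal_pow]

variable [DecidableEq ι]

theorem star_mulVec_dotProduct_mulVec (U : Matrix.unitaryGroup ι ℂ) (u v : ι → ℂ) :
    star ((star (U : Matrix ι ι ℂ)).mulVec u) ⬝ᵥ (star (U : Matrix ι ι ℂ)).mulVec v =
      star u ⬝ᵥ v := by
  rw [Matrix.star_mulVec, ← Matrix.dotProduct_mulVec, Matrix.mulVec_mulVec,
    ← Matrix.star_eq_conjTranspose, star_star, Unitary.mul_star_self_of_mem U.2, Matrix.one_mulVec]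

theorem sum_norm_sq_star_mulVec (U : Matrix.unitaryGroup ι ℂ) (u : ι → ℂ) :
    ∑ i, ‖(star (U : Matrix ι ι ℂ)).mulVec u i‖ ^ 2 = ∑ i, ‖u i‖ ^ 2 := by
  apply Complex.ofReal_injective
  rw [← star_dotProduct_self, ← star_dotProduct_self, star_mulVec_dotProduct_mulVec]

theorem sum_norm_sq_column (U : Matrix.unitaryGroup ι ℂ) (i₀ : ι) : ∑ i, ‖U i i₀‖ ^ 2 = 1 := by
  apply Complex.ofReal_injective
  rw [← star_dotProduct_self, Complex.ofReal_one]
  exact (congrFun₂ (Unitary.coe_star_mul_self U) i₀ i₀).trans (Matrix.one_apply_eq i₀)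

theorem exists_unitary_column (ψ : ι → ℂ) (hψ : ∑ i, ‖ψ i‖ ^ 2 = 1) (i₀ : ι) :
    ∃ U : Matrix.unitaryGroup ι ℂ, ∀ i, U i i₀ = ψ i := by
  set v : ι → EuclideanSpace ℂ ι := fun _ => WithLp.toLp 2 ψ
  have hv (i : ι) : ‖v i‖ = 1 := by rwa [EuclideanSpace.norm_eq, Real.sqrt_eq_one]
  obtain ⟨b, hb⟩ := Orthonormal.exists_orthonormalBasis_extension_of_card_eq (𝕜 := ℂ)
    finrank_euclideanSpace (v := v) (s := {i₀})
    ⟨fun i => hv i, fun i j hij => (hij (Subsingleton.elim i j)).elim⟩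
  refine ⟨⟨(EuclideanSpace.basisFun ι ℂ).toBasis.toMatrix b,
    (EuclideanSpace.basisFun ι ℂ).toMatrix_orthonormalBasis_mem_unitary b⟩, fun i => ?_⟩
  change (EuclideanSpace.basisFun ι ℂ).toBasis.toMatrix b i i₀ = ψ i
  rw [Module.Basis.toMatrix_apply, hb i₀ rfl]
  rfl

theorem star_eigenvectorUnitary_mulVec_mulVec {A : Matrix ι ι ℂ} (hA : A.IsHermitian) (u : ι → ℂ)
    (i : ι) : (star (hA.eigenvectorUnitary : Matrix ι ι ℂ)).mulVec (A.mulVec u) i =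
      hA.eigenvalues i * (star (hA.eigenvectorUnitary : Matrix ι ι ℂ)).mulVec u i := by
  have hcomm : star (hA.eigenvectorUnitary : Matrix ι ι ℂ) * A =
      Matrix.diagonal (RCLike.ofReal ∘ hA.eigenvalues) *
        star (hA.eigenvectorUnitary : Matrix ι ι ℂ) := by
    conv_lhs => enter [2]; rw [hA.spectral_theorem]
    rw [Unitary.conjStarAlgAut_apply, ← mul_assoc, ← mul_assoc,
      Unitary.coe_star_mul_self, one_mul]
  rw [Matrix.mulVec_mulVec, hcomm, ← Matrix.mulVec_mulVec, Matrix.mulVec_diagonal]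
  rfl

theorem star_dotProduct_mulVec_eq_sum {A : Matrix ι ι ℂ} (hA : A.IsHermitian) (u : ι → ℂ) :
    star u ⬝ᵥ A.mulVec u = ((∑ i, hA.eigenvalues i *
      ‖(star (hA.eigenvectorUnitary : Matrix ι ι ℂ)).mulVec u i‖ ^ 2 : ℝ) : ℂ) := by
  rw [← star_mulVec_dotProduct_mulVec hA.eigenvectorUnitary, dotProduct, Complex.ofReal_sum]
  refine Finset.sum_congr rfl fun i _ => ?_
  rw [star_eigenvectorUnitary_mulVec_mulVec, Pi.star_apply, mul_left_comm, RCLike.star_def,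
    Complex.conj_mul', Complex.ofReal_mul, Complex.ofReal_pow]

end UnitaryVectors

/-! ### Pointer measurements -/

section Pointer

variable {m d : ℕ} {O ρ : Op d}

/-- The phase that the ancilla state `i` acquires when the observable has the value `x`. It is
defined for all integers `i`, so that the index can be shifted. -/
def phase (m : ℕ) (θ x : ℝ) (i : ℤ) : ℂ :=
  Complex.exp (-Complex.I * ((θ * ((i : ℝ) - 2 ^ m / 2) : ℝ) : ℂ) * x)

theorem norm_phase (θ x : ℝ) (i : ℤ) : ‖phase m θ x i‖ = 1 := by
  have hphase : phase m θ x i =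
      Complex.exp (((-(θ * ((i : ℝ) - 2 ^ m / 2) * x) : ℝ) : ℂ) * Complex.I) := by
    rw [phase]
    congr 1
    push_cast
    ring
  rw [hphase, Complex.norm_exp_ofReal_mul_I]

/-- The pointer measurement: prepare the ancillas in the state given by the first column of `U`, let
them interact once with the observable for the time `θ`, and measure in the basis given by `W`. -/
def pointer (U W : Matrix.unitaryGroup (Fin (2 ^ m)) ℂ) (θ : ℝ) (y : Fin (2 ^ m) → ℝ) :
    Measurement where
  ancillas := m
  gates := [.ancilla U, .evolve θ, .ancilla (star W)]
  readout := y

theorem pointer_time (U W : Matrix.unitaryGroup (Fin (2 ^ m)) ℂ) (θ : ℝ) (y : Fin (2 ^ m) → ℝ) :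
    (pointer U W θ y).time = |θ| * (2 ^ m / 2) := by
  simp [pointer, Measurement.time, Gate.time]

/-- The state of the ancillas, prepared in the state `ψ`, after the interaction with an observable
of value `x`. -/
def pointerState (ψ : Fin (2 ^ m) → ℂ) (θ x : ℝ) (ℓ : Fin (2 ^ m)) : ℂ :=
  ψ ℓ * phase m θ x (ℓ : ℕ)

variable (U W : Matrix.unitaryGroup (Fin (2 ^ m)) ℂ) (θ : ℝ)

/-- The amplitude of the result `j` when the observable has the value `x`. -/
def amplitude (j : Fin (2 ^ m)) (x : ℝ) : ℂ :=
  (star (W : Op (2 ^ m))).mulVec (pointerState (fun ℓ => U ℓ ⟨0, by positivity⟩) θ x) j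

/-- The probability of the result `j` when the observable has the value `x`. -/
def likelihood (j : Fin (2 ^ m)) (x : ℝ) : ℝ := ‖amplitude U W θ j x‖ ^ 2

theorem likelihood_nonneg (j : Fin (2 ^ m)) (x : ℝ) : 0 ≤ likelihood U W θ j x := sq_nonneg _

theorem sum_likelihood (x : ℝ) : ∑ j, likelihood U W θ j x = 1 := by
  simp only [likelihood, amplitude, sum_norm_sq_star_mulVec, pointerState, norm_mul, norm_phase,
    mul_one, sum_norm_sq_column]

theorem amplitude_eq_sum (j : Fin (2 ^ m)) (x : ℝ) :
    amplitude U W θ j x =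
      ∑ ℓ, (star (W : Op (2 ^ m))) j ℓ * U ℓ ⟨0, by positivity⟩ * phase m θ x (ℓ : ℕ) := by
  simp only [amplitude, Matrix.mulVec, dotProduct, pointerState, mul_assoc]

theorem kronecker_mul_blockDiagonal_mul_kronecker_apply {ι κ : Type*} [Fintype ι] [DecidableEq ι]
    [Fintype κ] [DecidableEq κ] (A B : Matrix κ κ ℂ) (V : κ → Matrix ι ι ℂ) (a b : ι) (j k : κ) :
    (((1 : Matrix ι ι ℂ) ⊗ₖ B) * (Matrix.blockDiagonal V * ((1 : Matrix ι ι ℂ) ⊗ₖ A))) (a, j)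
      (b, k) = ∑ ℓ, B j ℓ * A ℓ k * V ℓ a b := by
  simp only [Matrix.mul_apply, Fintype.sum_prod_type, Matrix.kroneckerMap_apply,
    Matrix.blockDiagonal_apply, Matrix.one_apply, mul_ite, ite_mul, mul_zero, zero_mul, one_mul,
    Finset.sum_ite_irrel, Finset.sum_ite_eq, Finset.sum_ite_eq', Finset.mem_univ, if_true,
    Finset.sum_const_zero]
  exact Finset.sum_congr rfl fun ℓ _ => by ring

/-- The Kraus operators of the pointer measurement. -/
def pointerKraus (O : Op d) (j : Fin (2 ^ m)) : Op d :=
  ∑ ℓ : Fin (2 ^ m), (star (W : Op (2 ^ m)) j ℓ * U ℓ ⟨0, by positivity⟩) •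
    NormedSpace.exp ((-Complex.I * ((θ * (((ℓ : ℕ) : ℝ) - 2 ^ m / 2) : ℝ) : ℂ)) • O)

theorem pointer_kraus (y : Fin (2 ^ m) → ℝ) (O : Op d) :
    (pointer U W θ y).kraus O = pointerKraus U W θ O := by
  refine funext fun (j : Fin (2 ^ m)) => Matrix.ext fun a b => ?_
  calc (pointer U W θ y).kraus O j a b
      = (((1 : Op d) ⊗ₖ star (W : Op (2 ^ m))) * (Matrix.blockDiagonal (fun ℓ : Fin (2 ^ m) =>
          NormedSpace.exp ((-Complex.I * ((θ * (((ℓ : ℕ) : ℝ) - 2 ^ m / 2) : ℝ) : ℂ)) • O)) *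
          (((1 : Op d) ⊗ₖ (U : Op (2 ^ m))) * 1)) :
            Matrix (Fin d × Fin (2 ^ m)) (Fin d × Fin (2 ^ m)) ℂ)
              (a, j) (b, ⟨0, by positivity⟩) := rfl
    _ = pointerKraus U W θ O j a b := by
        rw [mul_one, kronecker_mul_blockDiagonal_mul_kronecker_apply, pointerKraus,
          Matrix.sum_apply]
        rfl

theorem pointerKraus_eq_spectralMap (hO : O.IsHermitian) (j : Fin (2 ^ m)) :
    pointerKraus U W θ O j =
      spectralMap hO fun a => amplitude U W θ j (hO.eigenvalues a) := by
  simp only [pointerKraus, exp_smul_eq_spectralMap hO]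
  rw [← Finset.sum_congr rfl fun ℓ _ => map_smul (spectralMap hO) _ _, ← map_sum]
  congr 1
  ext a
  simp only [Finset.sum_apply, Pi.smul_apply, smul_eq_mul, amplitude_eq_sum, phase,
    Int.cast_natCast]

theorem effect_pointerKraus (w : Fin (2 ^ m) → ℝ) (hO : O.IsHermitian) :
    effect (pointerKraus U W θ O) w = spectralMap hO fun a =>
      ((∑ j, w j * likelihood U W θ j (hO.eigenvalues a) : ℝ) : ℂ) := by
  have hterm (j : Fin (2 ^ m)) :
      w j • ((pointerKraus U W θ O j).conjTranspose * pointerKraus U W θ O j) =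
        spectralMap hO fun a => ((w j * likelihood U W θ j (hO.eigenvalues a) : ℝ) : ℂ) := by
    rw [pointerKraus_eq_spectralMap U W θ hO, ← Matrix.star_eq_conjTranspose, ← map_star,
      ← map_mul, ← Complex.coe_smul, ← map_smul]
    congr 1
    ext a
    rw [Pi.smul_apply, Pi.mul_apply, Pi.star_apply, RCLike.star_def, Complex.conj_mul', likelihood,
      smul_eq_mul, Complex.ofReal_mul, Complex.ofReal_pow]
  refine (Finset.sum_congr rfl fun j _ => hterm j).trans ?_
  rw [← map_sum]
  congr 1
  ext a
  rw [Finset.sum_apply, Complex.ofReal_sum]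

theorem expect_effect_pointerKraus (w : Fin (2 ^ m) → ℝ) (hO : O.IsHermitian) (ρ : Op d) :
    expect ρ (effect (pointerKraus U W θ O) w) =
      ∑ a, spectralWeight hO ρ a * ∑ j, w j * likelihood U W θ j (hO.eigenvalues a) := by
  rw [effect_pointerKraus U W θ w hO, expect_spectralMap]

theorem isCommutingInstrument_pointerKraus (hO : O.IsHermitian)
    (hρO : Commute ρ O) : IsCommutingInstrument ρ (pointerKraus U W θ O) where
  sum_eq_one := by
    have h := effect_pointerKraus U W θ 1 hO
    simp only [effect, Pi.one_apply, one_smul, one_mul, sum_likelihood, Complex.ofReal_one] at h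
    exact h.trans (map_one _)
  normal j := by
    rw [pointerKraus_eq_spectralMap U W θ hO, ← Matrix.star_eq_conjTranspose, ← map_star]
    exact (Commute.all _ _).map (spectralMap hO)
  commute_state j := by
    rw [pointerKraus]
    exact Commute.sum_right _ _ _ fun ℓ _ => ((hρO.smul_right _).exp_right).smul_right _

/-- The measurement with readout `y` is accurate on the interval `[-κ, κ]`: its bias is at most
`ε / 2` and its mean square error at most `2`. -/
structure IsAccurate (y : Fin (2 ^ m) → ℝ) (κ ε : ℝ) : Prop where
  bias : ∀ x, |x| ≤ κ → |∑ j, y j * likelihood U W θ j x - x| ≤ ε / 2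
  error : ∀ x, |x| ≤ κ → ∑ j, (y j - x) ^ 2 * likelihood U W θ j x ≤ 2

namespace IsAccurate

variable {U W θ} {y : Fin (2 ^ m) → ℝ} {κ ε : ℝ}

theorem abs_expect_effect_sub_le (h : IsAccurate U W θ y κ ε) (hO : O.IsHermitian)
    (hρ : ρ.PosSemidef) (hρ1 : ρ.trace = 1) (hκ : opNorm O ≤ κ) :
    |expect ρ (effect (pointerKraus U W θ O) y) - expect ρ O| ≤ ε / 2 := by
  rw [expect_effect_pointerKraus U W θ y hO, expect_eq_sum hO, ← Finset.sum_sub_distrib]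
  calc _ ≤ ∑ a, spectralWeight hO ρ a * (ε / 2) := by
        refine (Finset.abs_sum_le_sum_abs _ _).trans (Finset.sum_le_sum fun a _ => ?_)
        rw [← mul_sub, abs_mul, abs_of_nonneg (spectralWeight_nonneg hO hρ a)]
        exact mul_le_mul_of_nonneg_left (h.bias _ ((abs_eigenvalues_le_opNorm hO a).trans hκ))
          (spectralWeight_nonneg hO hρ a)
    _ = ε / 2 := by rw [← Finset.sum_mul, sum_spectralWeight hO hρ1, one_mul]

theorem sum_sq_sub_mul_likelihood_le (h : IsAccurate U W θ y κ ε) {x : ℝ} (hx : |x| ≤ κ) (μ : ℝ) :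
    ∑ j, (y j - μ) ^ 2 * likelihood U W θ j x ≤ 4 + 2 * (x - μ) ^ 2 :=
  calc _ ≤ ∑ j, (2 * ((y j - x) ^ 2 + (x - μ) ^ 2)) * likelihood U W θ j x := by
        refine Finset.sum_le_sum fun j _ =>
          mul_le_mul_of_nonneg_right ?_ (likelihood_nonneg U W θ j x)
        rw [← sub_add_sub_cancel (y j) x μ]
        exact add_sq_le
    _ = 2 * ∑ j, (y j - x) ^ 2 * likelihood U W θ j x + 2 * (x - μ) ^ 2 := by
        simp only [mul_add, add_mul, Finset.sum_add_distrib]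
        rw [← Finset.mul_sum, sum_likelihood, mul_one, Finset.mul_sum]
        simp only [mul_assoc]
    _ ≤ 4 + 2 * (x - μ) ^ 2 := by linarith [h.error x hx]

theorem expect_effect_sub_sq_le (h : IsAccurate U W θ y κ ε) (hO : O.IsHermitian)
    (hρ : ρ.PosSemidef) (hρ1 : ρ.trace = 1) (hκ : opNorm O ≤ κ) {μ : ℝ}
    (hμ : |μ - expect ρ O| ≤ 1 / 2) :
    expect ρ (effect (pointerKraus U W θ O) fun j => (y j - μ) ^ 2) ≤
      5 * (variance ρ O + 1) := by
  have hshift : (expect ρ O - μ) ^ 2 ≤ (1 / 2) ^ 2 := by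
    rw [← sq_abs, abs_sub_comm]
    gcongr
  calc _ ≤ ∑ a, spectralWeight hO ρ a * (4 + 2 * (hO.eigenvalues a - μ) ^ 2) := by
        rw [expect_effect_pointerKraus U W θ _ hO]
        exact Finset.sum_le_sum fun a _ => mul_le_mul_of_nonneg_left
          (h.sum_sq_sub_mul_likelihood_le ((abs_eigenvalues_le_opNorm hO a).trans hκ) μ)
          (spectralWeight_nonneg hO hρ a)
    _ = 4 + 2 * (variance ρ O + (expect ρ O - μ) ^ 2) := by
        simp only [mul_add, mul_left_comm _ (2 : ℝ), Finset.sum_add_distrib]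
        rw [← Finset.sum_mul, ← Finset.mul_sum, sum_spectralWeight hO hρ1,
          sum_spectralWeight_mul_sub_sq hO hρ1]
        ring
    _ ≤ 5 * (variance ρ O + 1) := by linarith [variance_nonneg hO hρ hρ1]

end IsAccurate

end Pointer

/-! ### Trigonometric approximation of the identity near zero -/

section Sawtooth

/-- The coefficients of the polynomial `z ↦ logTaylor D ((z - 1) / 2)`. On the unit circle
`(z + 1) / 2` has the argument `φ / 2`, so the imaginary part of this polynomial at `e^{iφ}`
approximates `φ / 2`. -/
def sawtoothCoeff (D k : ℕ) : ℝ :=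
  ∑ n ∈ Finset.range D, (-1) ^ (n + 1) / n * ((-1) ^ (n - k) * n.choose k / 2 ^ n)

theorem sum_range_mul_choose {R : Type*} [CommRing R] {D n : ℕ} (hn : n < D) (f : ℕ → R) :
    ∑ k ∈ Finset.range D, f k * (n.choose k : R) =
      ∑ k ∈ Finset.range (n + 1), f k * (n.choose k : R) := by
  symm
  refine Finset.sum_subset (Finset.range_subset_range.2 hn) fun k _ hk => ?_
  rw [Nat.choose_eq_zero_of_lt (by simpa using hk), Nat.cast_zero, mul_zero]

theorem sum_sawtoothCoeff_mul_pow (D : ℕ) (z : ℂ) :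
    ∑ k ∈ Finset.range D, (sawtoothCoeff D k : ℂ) * z ^ k =
      Complex.logTaylor D ((z - 1) / 2) := by
  simp only [sawtoothCoeff, Complex.ofReal_sum, Finset.sum_mul]
  rw [Finset.sum_comm, Complex.logTaylor]
  refine Finset.sum_congr rfl fun n hn => ?_
  calc ∑ k ∈ Finset.range D,
        (((-1) ^ (n + 1) / n * ((-1) ^ (n - k) * n.choose k / 2 ^ n) : ℝ) : ℂ) * z ^ k
      = (-1) ^ (n + 1) / n / 2 ^ n *
          ∑ k ∈ Finset.range D, (z ^ k * (-1) ^ (n - k)) * (n.choose k : ℂ) := by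
        rw [Finset.mul_sum]
        refine Finset.sum_congr rfl fun k _ => ?_
        push_cast
        ring
    _ = (-1) ^ (n + 1) / n / 2 ^ n * (z - 1) ^ n := by
        rw [sum_range_mul_choose (Finset.mem_range.1 hn), ← add_pow, ← sub_eq_add_neg]
    _ = (-1) ^ (n + 1) * ((z - 1) / 2) ^ n / n := by
        rw [div_pow]
        ring

theorem sum_abs_sawtoothCoeff_le (D : ℕ) : ∑ k ∈ Finset.range D, |sawtoothCoeff D k| ≤ D := by
  have hterm (n k : ℕ) :
      |(-1 : ℝ) ^ (n + 1) / n * ((-1) ^ (n - k) * n.choose k / 2 ^ n)| ≤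
        1 / 2 ^ n * (1 * n.choose k) := by
    rw [abs_mul, abs_div, abs_div, abs_mul, abs_neg_one_pow, abs_neg_one_pow, Nat.abs_cast,
      Nat.abs_cast, abs_of_pos (by positivity : (0 : ℝ) < 2 ^ n)]
    calc _ ≤ 1 * (1 * (n.choose k : ℝ) / 2 ^ n) :=
          mul_le_mul_of_nonneg_right (by rw [one_div]; exact Nat.cast_inv_le_one n) (by positivity)
      _ = 1 / 2 ^ n * (1 * n.choose k) := by ring
  have hrow {n : ℕ} (hn : n < D) :
      ∑ k ∈ Finset.range D, 1 / 2 ^ n * (1 * (n.choose k : ℝ)) = 1 := by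
    rw [← Finset.mul_sum, sum_range_mul_choose hn fun _ => (1 : ℝ)]
    simp only [one_mul]
    rw [← Nat.cast_sum, Nat.sum_range_choose, Nat.cast_pow, Nat.cast_ofNat,
      one_div_mul_cancel (by positivity)]
  calc ∑ k ∈ Finset.range D, |sawtoothCoeff D k|
      ≤ ∑ k ∈ Finset.range D, ∑ n ∈ Finset.range D, 1 / 2 ^ n * (1 * (n.choose k : ℝ)) :=
        Finset.sum_le_sum fun k _ => (Finset.abs_sum_le_sum_abs _ _).trans
          (Finset.sum_le_sum fun n _ => hterm n k)
    _ = ∑ n ∈ Finset.range D, 1 := by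
        rw [Finset.sum_comm]
        exact Finset.sum_congr rfl fun n hn => hrow (Finset.mem_range.1 hn)
    _ = D := by rw [Finset.sum_const, Finset.card_range, nsmul_one]

theorem sum_sawtoothCoeff_mul_sin (D : ℕ) (φ : ℝ) :
    ∑ k ∈ Finset.range D, sawtoothCoeff D k * Real.sin (k * φ) =
      (Complex.logTaylor D ((Complex.exp (φ * Complex.I) - 1) / 2)).im := by
  rw [← sum_sawtoothCoeff_mul_pow, Complex.im_sum]
  refine Finset.sum_congr rfl fun k _ => ?_
  rw [Complex.im_ofReal_mul, ← Complex.exp_nat_mul, ← mul_assoc, ← Complex.ofReal_natCast,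
    ← Complex.ofReal_mul, Complex.exp_ofReal_mul_I_im]

theorem im_log_one_add_half_exp_sub_one {φ : ℝ} (hφ : |φ| < Real.pi) :
    (Complex.log (1 + (Complex.exp (φ * Complex.I) - 1) / 2)).im = φ / 2 := by
  obtain ⟨hlow, hhigh⟩ := abs_lt.1 hφ
  have hcos : 0 < Real.cos (φ / 2) := Real.cos_pos_of_mem_Ioo ⟨by linarith, by linarith⟩
  have hpolar : 1 + (Complex.exp (φ * Complex.I) - 1) / 2 = (Real.cos (φ / 2) : ℝ) *
      (Complex.cos ((φ / 2 : ℝ) : ℂ) + Complex.sin ((φ / 2 : ℝ) : ℂ) * Complex.I) := by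
    rw [← Complex.exp_mul_I, Complex.ofReal_cos, Complex.cos, div_mul_eq_mul_div, add_mul,
      ← Complex.exp_add, ← Complex.exp_add, neg_mul, neg_add_cancel, Complex.exp_zero, ← add_mul,
      ← Complex.ofReal_add, add_halves]
    ring
  rw [Complex.log_im, hpolar, Complex.arg_mul_cos_add_sin_mul_I hcos]
  constructor <;> linarith

theorem norm_log_sub_logTaylor_le_of_norm_le {n : ℕ} {w : ℂ} {r : ℝ} (hw : ‖w‖ ≤ r) (hr : r < 1) :
    ‖Complex.log (1 + w) - Complex.logTaylor (n + 1) w‖ ≤ r ^ (n + 1) * (1 - r)⁻¹ := by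
  have hw1 : 0 < 1 - ‖w‖ := by linarith
  have hr0 : 0 ≤ r := (norm_nonneg w).trans hw
  have hr1 : 0 < 1 - r := by linarith
  calc ‖Complex.log (1 + w) - Complex.logTaylor (n + 1) w‖
      ≤ ‖w‖ ^ (n + 1) * (1 - ‖w‖)⁻¹ / (n + 1) :=
        Complex.norm_log_sub_logTaylor_le n (by linarith)
    _ ≤ ‖w‖ ^ (n + 1) * (1 - ‖w‖)⁻¹ :=
        div_le_self (by positivity) (le_add_of_nonneg_left n.cast_nonneg)
    _ ≤ r ^ (n + 1) * (1 - r)⁻¹ := by gcongr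

theorem abs_sum_sawtoothCoeff_sub_le {D : ℕ} (hD : 1 ≤ D) {φ : ℝ} (hφ : |φ| ≤ 1 / 2) :
    |∑ k ∈ Finset.range D, sawtoothCoeff D k * (2 * Real.sin (k * φ)) - φ| ≤ 3 / 4 ^ D := by
  obtain ⟨n, rfl⟩ := Nat.exists_eq_add_of_le' hD
  set w : ℂ := (Complex.exp (φ * Complex.I) - 1) / 2 with hw
  have hwnorm : ‖w‖ ≤ 1 / 4 := by
    have hexp := Real.norm_exp_I_mul_ofReal_sub_one_le (x := φ)
    rw [mul_comm, Real.norm_eq_abs] at hexp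
    rw [hw, norm_div, Complex.norm_ofNat]
    linarith
  have htaylor : |(Complex.log (1 + w) - Complex.logTaylor (n + 1) w).im| ≤
      (1 / 4) ^ (n + 1) * (1 - 1 / 4)⁻¹ :=
    (Complex.abs_im_le_norm _).trans (norm_log_sub_logTaylor_le_of_norm_le hwnorm (by norm_num))
  rw [Complex.sub_im, im_log_one_add_half_exp_sub_one (by linarith [Real.pi_gt_three]),
    ← sum_sawtoothCoeff_mul_sin] at htaylor
  calc |∑ k ∈ Finset.range (n + 1), sawtoothCoeff (n + 1) k * (2 * Real.sin (k * φ)) - φ|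
      = 2 * |φ / 2 - ∑ k ∈ Finset.range (n + 1), sawtoothCoeff (n + 1) k * Real.sin (k * φ)| := by
        simp only [mul_left_comm _ (2 : ℝ)]
        rw [← Finset.mul_sum, abs_sub_comm, ← abs_two, ← abs_mul, abs_two, mul_sub,
          mul_div_cancel₀ φ two_ne_zero]
    _ ≤ 2 * ((1 / 4) ^ (n + 1) * (1 - 1 / 4)⁻¹) := by gcongr
    _ ≤ 3 / 4 ^ (n + 1) := by
        rw [one_div_pow, div_eq_mul_one_div 3]
        nlinarith [(by positivity : (0 : ℝ) < 1 / 4 ^ (n + 1))]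

end Sawtooth

/-! ### The triangular window -/

section Window

/-- A triangular bump on the integers, supported in `[0, L)`. -/
def tent (L : ℕ) (i : ℤ) : ℝ := max 0 (min ((i : ℝ) + 1) (L - i))

variable {L : ℕ}

theorem tent_nonneg (i : ℤ) : 0 ≤ tent L i := le_max_left _ _

theorem tent_le (i : ℤ) : tent L i ≤ L := by
  refine max_le (Nat.cast_nonneg L) ?_
  rcases le_or_gt 0 i with hi | hi
  · exact (min_le_right _ _).trans (sub_le_self _ (by exact_mod_cast hi))
  · exact (min_le_left _ _).trans
      (le_trans (by exact_mod_cast Int.add_one_le_of_lt hi) (Nat.cast_nonneg L))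

theorem tent_eq_zero {i : ℤ} (hi : i < 0 ∨ (L : ℤ) ≤ i) : tent L i = 0 := by
  refine max_eq_left ?_
  rcases hi with hi | hi
  · exact (min_le_left _ _).trans (by exact_mod_cast Int.add_one_le_of_lt hi)
  · exact (min_le_right _ _).trans (sub_nonpos.2 (by exact_mod_cast hi))

theorem abs_tent_sub_le (i j : ℤ) : |tent L i - tent L j| ≤ |(i : ℝ) - j| := by
  refine (abs_max_sub_max_le_max _ _ _ _).trans (max_le (by simp) ?_)
  refine (abs_min_sub_min_le_max _ _ _ _).trans (max_le ?_ ?_)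
  · rw [add_sub_add_right_eq_sub]
  · rw [sub_sub_sub_cancel_left, abs_sub_comm]

theorem tent_reflect (i : ℤ) : tent L (L - 1 - i) = tent L i := by
  unfold tent
  rw [min_comm]
  push_cast
  congr 2 <;> ring

theorem le_sum_tent_sq {M : ℕ} (hL : L = 4 * M) :
    (L : ℝ) ^ 3 / 32 ≤ ∑ ℓ : Fin L, tent L ((ℓ : ℕ) : ℤ) ^ 2 := by
  have hmiddle {ℓ : ℕ} (hℓ : ℓ ∈ Finset.Ico M (3 * M)) : (M : ℝ) ≤ tent L ℓ := by
    rw [Finset.mem_Ico] at hℓ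
    refine le_max_of_le_right (le_min ?_ ?_)
    · have : (M : ℝ) ≤ ℓ := by exact_mod_cast hℓ.1
      push_cast
      linarith
    · have : (ℓ : ℝ) ≤ 3 * M := by exact_mod_cast hℓ.2.le
      rw [hL]
      push_cast
      linarith
  have hsubset : Finset.Ico M (3 * M) ⊆ Finset.range L := by
    intro ℓ hℓ
    rw [Finset.mem_Ico] at hℓ
    rw [Finset.mem_range]
    omega
  rw [Fin.sum_univ_eq_sum_range (fun ℓ => tent L (ℓ : ℤ) ^ 2) L]
  calc (L : ℝ) ^ 3 / 32 = ∑ _ ∈ Finset.Ico M (3 * M), (M : ℝ) ^ 2 := by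
        rw [Finset.sum_const, Nat.card_Ico, nsmul_eq_mul, hL, (by omega : 3 * M - M = 2 * M)]
        push_cast
        ring
    _ ≤ ∑ ℓ ∈ Finset.Ico M (3 * M), tent L ℓ ^ 2 :=
        Finset.sum_le_sum fun _ hℓ => pow_le_pow_left₀ (Nat.cast_nonneg M) (hmiddle hℓ) 2
    _ ≤ ∑ ℓ ∈ Finset.range L, tent L ℓ ^ 2 :=
        Finset.sum_le_sum_of_subset_of_nonneg hsubset fun _ _ _ => sq_nonneg _

/-- The factor that normalizes the triangular window on `2 ^ m` points. -/
def windowScale (m : ℕ) : ℝ := (Real.sqrt (∑ ℓ : Fin (2 ^ m), tent (2 ^ m) ((ℓ : ℕ) : ℤ) ^ 2))⁻¹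

/-- The normalized triangular window, used as the initial wave function of the ancillas. -/
def window (m : ℕ) (i : ℤ) : ℝ := windowScale m * tent (2 ^ m) i

/-- The overlap of the window with its translate by `k`. -/
def overlap (m k : ℕ) : ℝ := ∑ ℓ : Fin (2 ^ m), window m (ℓ : ℕ) * window m ((ℓ : ℕ) + k)

variable {m : ℕ}

theorem windowScale_nonneg : 0 ≤ windowScale m := inv_nonneg.2 (Real.sqrt_nonneg _)

theorem two_pow_eq_four_mul (hm : 2 ≤ m) : 2 ^ m = 4 * 2 ^ (m - 2) :=
  (pow_mul_pow_sub 2 hm).symm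

theorem sum_tent_sq_pos (hm : 2 ≤ m) : 0 < ∑ ℓ : Fin (2 ^ m), tent (2 ^ m) ((ℓ : ℕ) : ℤ) ^ 2 :=
  lt_of_lt_of_le (by positivity) (le_sum_tent_sq (two_pow_eq_four_mul hm))

theorem windowScale_sq_le (hm : 2 ≤ m) : windowScale m ^ 2 ≤ 32 / (2 ^ m : ℝ) ^ 3 := by
  have hsum := le_sum_tent_sq (two_pow_eq_four_mul hm)
  rw [Nat.cast_pow, Nat.cast_ofNat] at hsum
  rw [windowScale, inv_pow, Real.sq_sqrt (sum_tent_sq_pos hm).le, ← inv_div]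
  exact inv_anti₀ (by positivity) hsum

theorem sum_window_sq (hm : 2 ≤ m) : ∑ ℓ : Fin (2 ^ m), window m (ℓ : ℕ) ^ 2 = 1 := by
  simp only [window, mul_pow]
  rw [← Finset.mul_sum, windowScale, inv_pow, Real.sq_sqrt (sum_tent_sq_pos hm).le]
  exact inv_mul_cancel₀ (sum_tent_sq_pos hm).ne'

theorem window_nonneg (i : ℤ) : 0 ≤ window m i := mul_nonneg windowScale_nonneg (tent_nonneg i)

theorem window_le (i : ℤ) : window m i ≤ windowScale m * 2 ^ m := by
  have htent := tent_le (L := 2 ^ m) i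
  rw [Nat.cast_pow, Nat.cast_ofNat] at htent
  exact mul_le_mul_of_nonneg_left htent windowScale_nonneg

theorem window_eq_zero {i : ℤ} (hi : i < 0 ∨ 2 ^ m ≤ i) : window m i = 0 := by
  rw [window, tent_eq_zero (by exact_mod_cast hi), mul_zero]

theorem window_reflect (i : ℤ) : window m (2 ^ m - 1 - i) = window m i := by
  have htent := tent_reflect (L := 2 ^ m) i
  rw [Nat.cast_pow, Nat.cast_ofNat] at htent
  rw [window, window, htent]

theorem abs_window_sub_le (i j : ℤ) :
    |window m i - window m j| ≤ windowScale m * |(i : ℝ) - j| := by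
  rw [window, window, ← mul_sub, abs_mul, abs_of_nonneg windowScale_nonneg]
  exact mul_le_mul_of_nonneg_left (abs_tent_sub_le i j) windowScale_nonneg

theorem sum_window_mul_window_sub (k : ℕ) :
    ∑ ℓ : Fin (2 ^ m), window m (ℓ : ℕ) * window m ((ℓ : ℕ) - k) = overlap m k := by
  rw [overlap, ← Equiv.sum_comp Fin.revPerm]
  refine Finset.sum_congr rfl fun ℓ _ => ?_
  have hrev : (((Fin.revPerm ℓ : Fin (2 ^ m)) : ℕ) : ℤ) = 2 ^ m - 1 - (ℓ : ℕ) := by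
    rw [Fin.revPerm_apply, Fin.val_rev, Nat.cast_sub (by omega)]
    push_cast
    ring
  rw [hrev, window_reflect, sub_sub, window_reflect]

theorem abs_one_sub_overlap_le (hm : 2 ≤ m) (k : ℕ) : |1 - overlap m k| ≤ 32 * k / 2 ^ m := by
  have hscale := windowScale_nonneg (m := m)
  have hterm (ℓ : Fin (2 ^ m)) :
      |window m (ℓ : ℕ) ^ 2 - window m (ℓ : ℕ) * window m ((ℓ : ℕ) + k)| ≤
        (windowScale m * 2 ^ m) * (windowScale m * k) := by
    rw [pow_two, ← mul_sub, abs_mul, abs_of_nonneg (window_nonneg _)]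
    refine mul_le_mul (window_le _) ?_ (abs_nonneg _) (by positivity)
    refine (abs_window_sub_le _ _).trans_eq ?_
    rw [Int.cast_add, sub_add_cancel_left, abs_neg, Int.cast_natCast k, Nat.abs_cast]
  calc |1 - overlap m k|
      ≤ ∑ ℓ : Fin (2 ^ m), (windowScale m * 2 ^ m) * (windowScale m * k) := by
        rw [← sum_window_sq hm, overlap, ← Finset.sum_sub_distrib]
        exact (Finset.abs_sum_le_sum_abs _ _).trans (Finset.sum_le_sum fun ℓ _ => hterm ℓ)
    _ = windowScale m ^ 2 * (2 ^ m) ^ 2 * k := by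
        rw [Finset.sum_const, Finset.card_univ, Fintype.card_fin, nsmul_eq_mul]
        push_cast
        ring
    _ ≤ 32 / (2 ^ m : ℝ) ^ 3 * (2 ^ m) ^ 2 * k := by
        gcongr
        exact windowScale_sq_le hm
    _ = 32 * k / 2 ^ m := by field_simp

theorem half_le_overlap (hm : 2 ≤ m) {k : ℕ} (hk : 64 * (k : ℝ) ≤ 2 ^ m) :
    1 / 2 ≤ overlap m k := by
  have hclose := (abs_le.1 (abs_one_sub_overlap_le hm k)).2
  have hsmall : 32 * (k : ℝ) / 2 ^ m ≤ 1 / 2 := by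
    rw [div_le_iff₀ (by positivity)]
    linarith
  linarith

theorem abs_window_div_overlap_sub_le (hm : 2 ≤ m) {k : ℕ} (hk : 64 * (k : ℝ) ≤ 2 ^ m) {i j : ℤ}
    (hij : |(i : ℝ) - j| ≤ k) :
    |window m i / overlap m k - window m j| ≤ 66 * windowScale m * k := by
  have hoverlap := half_le_overlap hm hk
  have hscale := windowScale_nonneg (m := m)
  have hsplit : window m i / overlap m k - window m j =
      ((window m i - window m j) + window m j * (1 - overlap m k)) / overlap m k := by
    have : overlap m k ≠ 0 := by linarith
    field_simp
    ring
  have hshift : |window m i - window m j| ≤ windowScale m * k :=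
    (abs_window_sub_le i j).trans (mul_le_mul_of_nonneg_left hij hscale)
  have hnormalize : |window m j * (1 - overlap m k)| ≤ 32 * (windowScale m * k) := by
    rw [abs_mul, abs_of_nonneg (window_nonneg j)]
    refine (mul_le_mul (window_le j) (abs_one_sub_overlap_le hm k) (abs_nonneg _)
      (by positivity)).trans_eq ?_
    field_simp
  rw [hsplit, abs_div, abs_of_pos (by linarith : 0 < overlap m k), div_le_iff₀ (by linarith)]
  calc _ ≤ 33 * (windowScale m * k) := (abs_add_le _ _).trans (by linarith)
    _ = 66 * windowScale m * k * (1 / 2) := by ring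
    _ ≤ 66 * windowScale m * k * overlap m k := by gcongr

end Window

/-! ### The pointer observable -/

section Twist

/-- The combination `-i (e^{iφ} a - e^{-iφ} b)` of two real numbers. A sine polynomial applied to
the translation of the ancilla register acts on the window through such combinations of the two
opposite translates, and for `a = b` it is `2 a sin φ`. -/
def twist (φ : ℝ) : ℝ × ℝ →ₗ[ℝ] ℂ where
  toFun p := -Complex.I *
    (Complex.exp (φ * Complex.I) * p.1 - Complex.exp (-(φ * Complex.I)) * p.2)
  map_add' p q := by
    rw [Prod.fst_add, Prod.snd_add]
    push_cast
    ring
  map_smul' c p := by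
    rw [Prod.smul_fst, Prod.smul_snd, RingHom.id_apply, Complex.real_smul, smul_eq_mul, smul_eq_mul]
    push_cast
    ring

theorem twist_apply (φ a b : ℝ) : twist φ (a, b) = -Complex.I *
    (Complex.exp (φ * Complex.I) * a - Complex.exp (-(φ * Complex.I)) * b) := rfl

theorem twist_self (φ a : ℝ) : twist φ (a, a) = ((2 * Real.sin φ * a : ℝ) : ℂ) := by
  rw [twist_apply]
  push_cast
  rw [Complex.sin]
  ring_nf

theorem norm_twist_le (φ a b : ℝ) : ‖twist φ (a, b)‖ ≤ |a| + |b| := by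
  rw [twist_apply, norm_mul, norm_neg, Complex.norm_I, one_mul]
  refine (norm_sub_le _ _).trans_eq ?_
  rw [norm_mul, norm_mul, Complex.norm_exp_ofReal_mul_I, ← neg_mul, ← Complex.ofReal_neg,
    Complex.norm_exp_ofReal_mul_I, one_mul, one_mul, Complex.norm_real, Complex.norm_real,
    Real.norm_eq_abs, Real.norm_eq_abs]

end Twist

section PointerObservable

variable {m : ℕ}

/-- The matrix of `θ⁻¹ ∑ k, 2 Q k sin (k P)`, where `P` is the generator of the translations of the
ancilla register; the overlaps compensate for the loss at the boundary of the register. -/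
def pointerObservable (m D : ℕ) (θ : ℝ) (Q : ℕ → ℝ) : Matrix (Fin (2 ^ m)) (Fin (2 ^ m)) ℂ :=
  Matrix.of fun ℓ ℓ' => ∑ k ∈ Finset.range D, ((Q k / (θ * overlap m k) : ℝ) : ℂ) * (-Complex.I) *
    ((if (ℓ : ℕ) = ℓ' + k then 1 else 0) - (if (ℓ' : ℕ) = ℓ + k then 1 else 0))

theorem pointerObservable_isHermitian (m D : ℕ) (θ : ℝ) (Q : ℕ → ℝ) :
    (pointerObservable m D θ Q).IsHermitian := by
  ext ℓ ℓ'
  rw [Matrix.conjTranspose_apply]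
  simp only [pointerObservable, Matrix.of_apply, star_sum]
  refine Finset.sum_congr rfl fun k _ => ?_
  rw [RCLike.star_def, map_mul, map_mul, Complex.conj_ofReal, map_neg, Complex.conj_I, map_sub,
    apply_ite (starRingEnd ℂ), apply_ite (starRingEnd ℂ), map_one, map_zero]
  ring

theorem sum_ite_eq_add_mul (u : ℤ → ℂ) (hu : ∀ i : ℤ, i < 0 ∨ 2 ^ m ≤ i → u i = 0)
    (ℓ : Fin (2 ^ m)) (k : ℕ) :
    ∑ ℓ' : Fin (2 ^ m), (if (ℓ : ℕ) = ℓ' + k then 1 else 0) * u (ℓ' : ℕ) = u ((ℓ : ℕ) - k) := by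
  by_cases hk : k ≤ ℓ
  · rw [Finset.sum_eq_single (⟨ℓ - k, by omega⟩ : Fin (2 ^ m)), if_pos (by simp only; omega),
      one_mul, Nat.cast_sub hk]
    · intro ℓ' _ hne
      rw [if_neg fun heq => hne (Fin.ext (by simp only; omega)), zero_mul]
    · exact fun hmem => (hmem (Finset.mem_univ _)).elim
  · rw [hu _ (Or.inl (by omega))]
    exact Finset.sum_eq_zero fun ℓ' _ => by rw [if_neg (by omega), zero_mul]

theorem sum_ite_add_eq_mul (u : ℤ → ℂ) (hu : ∀ i : ℤ, i < 0 ∨ 2 ^ m ≤ i → u i = 0)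
    (ℓ : Fin (2 ^ m)) (k : ℕ) :
    ∑ ℓ' : Fin (2 ^ m), (if (ℓ' : ℕ) = ℓ + k then 1 else 0) * u (ℓ' : ℕ) = u ((ℓ : ℕ) + k) := by
  by_cases hk : (ℓ : ℕ) + k < 2 ^ m
  · rw [Finset.sum_eq_single (⟨ℓ + k, hk⟩ : Fin (2 ^ m)), if_pos rfl, one_mul, Nat.cast_add]
    · intro ℓ' _ hne
      rw [if_neg fun heq => hne (Fin.ext heq), zero_mul]
    · exact fun hmem => (hmem (Finset.mem_univ _)).elim
  · rw [hu _ (Or.inr (by exact_mod_cast not_lt.1 hk))]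
    exact Finset.sum_eq_zero fun ℓ' _ => by rw [if_neg (by omega), zero_mul]

theorem phase_sub (θ x : ℝ) (i : ℤ) (k : ℕ) : phase m θ x (i - k) =
    phase m θ x i * Complex.exp ((k * (θ * x) : ℝ) * Complex.I) := by
  rw [phase, phase, ← Complex.exp_add]
  congr 1
  push_cast
  ring

theorem phase_add (θ x : ℝ) (i : ℤ) (k : ℕ) : phase m θ x (i + k) =
    phase m θ x i * Complex.exp (-((k * (θ * x) : ℝ) * Complex.I)) := by
  rw [phase, phase, ← Complex.exp_add]
  congr 1
  push_cast
  ring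

/-- The state of the ancillas, prepared in the triangular window, after the interaction with an
observable of value `x`. -/
def windowState (m : ℕ) (θ x : ℝ) : Fin (2 ^ m) → ℂ :=
  pointerState (fun ℓ => ((window m (ℓ : ℕ) : ℝ) : ℂ)) θ x

theorem pointerObservable_mulVec (D : ℕ) (θ x : ℝ) (Q : ℕ → ℝ) (ℓ : Fin (2 ^ m)) :
    (pointerObservable m D θ Q).mulVec (windowState m θ x) ℓ = phase m θ x (ℓ : ℕ) *
      ∑ k ∈ Finset.range D, (Q k / (θ * overlap m k)) •
        twist (k * (θ * x)) (window m ((ℓ : ℕ) - k), window m ((ℓ : ℕ) + k)) := by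
  set u : ℤ → ℂ := fun i => window m i * phase m θ x i with hu
  have hu0 : ∀ i : ℤ, i < 0 ∨ 2 ^ m ≤ i → u i = 0 := fun i hi => by
    simp only [hu, window_eq_zero hi, Complex.ofReal_zero, zero_mul]
  have hstate : windowState m θ x = fun ℓ' : Fin (2 ^ m) => u (ℓ' : ℕ) := rfl
  simp only [Matrix.mulVec, dotProduct, pointerObservable, Matrix.of_apply, hstate, Finset.sum_mul]
  rw [Finset.sum_comm, Finset.mul_sum]
  refine Finset.sum_congr rfl fun k _ => ?_
  simp only [mul_assoc, sub_mul]
  rw [← Finset.mul_sum, ← Finset.mul_sum, Finset.sum_sub_distrib, sum_ite_eq_add_mul u hu0,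
    sum_ite_add_eq_mul u hu0, twist_apply, Complex.real_smul]
  simp only [hu]
  rw [phase_sub, phase_add]
  ring

theorem star_windowState_mul (θ x : ℝ) (ℓ : Fin (2 ^ m)) (z : ℂ) :
    star (windowState m θ x ℓ) * (phase m θ x (ℓ : ℕ) * z) = window m (ℓ : ℕ) • z := by
  have hphase : star (phase m θ x (ℓ : ℕ)) * phase m θ x (ℓ : ℕ) = 1 := by
    rw [RCLike.star_def, Complex.conj_mul', norm_phase, Complex.ofReal_one, one_pow]
  have hwindow : star ((window m (ℓ : ℕ) : ℝ) : ℂ) = (window m (ℓ : ℕ) : ℝ) :=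
    Complex.conj_ofReal _
  rw [windowState, pointerState, star_mul', hwindow, Complex.real_smul]
  linear_combination ((window m (ℓ : ℕ) : ℝ) : ℂ) * z * hphase

theorem star_dotProduct_pointerObservable_mulVec {D : ℕ} {θ : ℝ}
    (hoverlap : ∀ k < D, overlap m k ≠ 0) (x : ℝ) (Q : ℕ → ℝ) :
    star (windowState m θ x) ⬝ᵥ (pointerObservable m D θ Q).mulVec (windowState m θ x) =
      ((θ⁻¹ * ∑ k ∈ Finset.range D, Q k * (2 * Real.sin (k * (θ * x))) : ℝ) : ℂ) := by
  have hterm (k : ℕ) (hk : k < D) : ∑ ℓ : Fin (2 ^ m), window m (ℓ : ℕ) •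
      (Q k / (θ * overlap m k)) •
        twist (k * (θ * x)) (window m ((ℓ : ℕ) - k), window m ((ℓ : ℕ) + k)) =
      ((θ⁻¹ * (Q k * (2 * Real.sin (k * (θ * x)))) : ℝ) : ℂ) := by
    simp only [smul_comm (window m _), ← map_smul (twist _) (window m _), Prod.smul_mk, smul_eq_mul]
    rw [← Finset.smul_sum, ← map_sum, ← prod_mk_sum, sum_window_mul_window_sub, ← overlap,
      twist_self, Complex.real_smul, ← Complex.ofReal_mul]
    have := hoverlap k hk
    congr 1
    rw [← div_div]
    field_simp
  simp only [dotProduct, Pi.star_apply, pointerObservable_mulVec, star_windowState_mul,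
    Finset.smul_sum]
  rw [Finset.sum_comm, Finset.mul_sum, Complex.ofReal_sum]
  exact Finset.sum_congr rfl fun k hk => hterm k (Finset.mem_range.1 hk)

theorem pointerObservable_mulVec_sub {D : ℕ} (θ x : ℝ) (Q : ℕ → ℝ) (ℓ : Fin (2 ^ m)) :
    (pointerObservable m D θ Q).mulVec (windowState m θ x) ℓ - x * windowState m θ x ℓ =
      phase m θ x (ℓ : ℕ) * (∑ k ∈ Finset.range D, (Q k / θ) • twist (k * (θ * x))
          (window m ((ℓ : ℕ) - k) / overlap m k - window m (ℓ : ℕ),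
            window m ((ℓ : ℕ) + k) / overlap m k - window m (ℓ : ℕ)) +
        (((θ⁻¹ * ∑ k ∈ Finset.range D, Q k * (2 * Real.sin (k * (θ * x))) - x) *
          window m (ℓ : ℕ) : ℝ) : ℂ)) := by
  have hterm (k : ℕ) : (Q k / θ) • twist (k * (θ * x))
      (window m ((ℓ : ℕ) - k) / overlap m k - window m (ℓ : ℕ),
        window m ((ℓ : ℕ) + k) / overlap m k - window m (ℓ : ℕ)) =
      (Q k / (θ * overlap m k)) •
        twist (k * (θ * x)) (window m ((ℓ : ℕ) - k), window m ((ℓ : ℕ) + k)) -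
      ((θ⁻¹ * (Q k * (2 * Real.sin (k * (θ * x)))) * window m (ℓ : ℕ) : ℝ) : ℂ) := by
    rw [← Prod.mk_sub_mk, map_sub, smul_sub, twist_self]
    congr 1
    · rw [twist_apply, twist_apply, Complex.real_smul, Complex.real_smul]
      push_cast
      ring
    · rw [Complex.real_smul]
      push_cast
      ring
  simp only [hterm, Finset.sum_sub_distrib]
  rw [pointerObservable_mulVec, windowState, pointerState, ← Complex.ofReal_sum, ← Finset.sum_mul,
    ← Finset.mul_sum]
  push_cast
  ring

theorem norm_pointerObservable_mulVec_sub_le (hm : 2 ≤ m) {D : ℕ} (hD : 64 * (D : ℝ) ≤ 2 ^ m)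
    {θ : ℝ} (hθ : 0 < θ) {Q : ℕ → ℝ} (hQ : ∑ k ∈ Finset.range D, |Q k| ≤ D) {x δ : ℝ}
    (hx : |θ⁻¹ * ∑ k ∈ Finset.range D, Q k * (2 * Real.sin (k * (θ * x))) - x| ≤ δ)
    (ℓ : Fin (2 ^ m)) :
    ‖(pointerObservable m D θ Q).mulVec (windowState m θ x) ℓ - x * windowState m θ x ℓ‖ ≤
      132 * windowScale m * D ^ 2 / θ + δ * window m (ℓ : ℕ) := by
  have hscale := windowScale_nonneg (m := m)
  have htranslate (k : ℕ) (hk : k < D) (i : ℤ) (hi : |(i : ℝ) - ((ℓ : ℕ) : ℤ)| ≤ k) :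
      |window m i / overlap m k - window m (ℓ : ℕ)| ≤ 66 * windowScale m * D := by
    have hkD : (k : ℝ) ≤ D := by exact_mod_cast hk.le
    exact (abs_window_div_overlap_sub_le hm (by linarith) hi).trans (by gcongr)
  have hterm (k : ℕ) (hk : k < D) : ‖(Q k / θ) • twist (k * (θ * x))
      (window m ((ℓ : ℕ) - k) / overlap m k - window m (ℓ : ℕ),
        window m ((ℓ : ℕ) + k) / overlap m k - window m (ℓ : ℕ))‖ ≤
      |Q k| * (132 * windowScale m * D / θ) := by
    have hleft := htranslate k hk ((ℓ : ℕ) - k)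
      (by push_cast; rw [sub_sub_cancel_left, abs_neg, Nat.abs_cast])
    have hright := htranslate k hk ((ℓ : ℕ) + k)
      (by push_cast; rw [add_sub_cancel_left, Nat.abs_cast])
    rw [norm_smul, Real.norm_eq_abs, abs_div, abs_of_pos hθ, div_mul_eq_mul_div, mul_div_assoc]
    gcongr
    exact (norm_twist_le _ _ _).trans (by linarith)
  rw [pointerObservable_mulVec_sub, norm_mul, norm_phase, one_mul]
  refine (norm_add_le _ _).trans (add_le_add ?_ ?_)
  · calc _ ≤ ∑ k ∈ Finset.range D, |Q k| * (132 * windowScale m * D / θ) :=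
          norm_sum_le_of_le _ fun k hk => hterm k (Finset.mem_range.1 hk)
      _ ≤ D * (132 * windowScale m * D / θ) := by
          rw [← Finset.sum_mul]
          gcongr
      _ = 132 * windowScale m * D ^ 2 / θ := by ring
  · rw [Complex.norm_real, Real.norm_eq_abs, abs_mul, abs_of_nonneg (window_nonneg _)]
    exact mul_le_mul_of_nonneg_right hx (window_nonneg _)

theorem sum_norm_sq_pointerObservable_sub_le (hm : 2 ≤ m) {D : ℕ} (hD : 64 * (D : ℝ) ≤ 2 ^ m)
    {θ : ℝ} (hθ : 0 < θ) (hθD : 2048 * (D : ℝ) ^ 2 ≤ θ * 2 ^ m) {Q : ℕ → ℝ}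
    (hQ : ∑ k ∈ Finset.range D, |Q k| ≤ D) {x δ : ℝ} (hδ : δ ≤ 1 / 2)
    (hx : |θ⁻¹ * ∑ k ∈ Finset.range D, Q k * (2 * Real.sin (k * (θ * x))) - x| ≤ δ) :
    ∑ ℓ, ‖(pointerObservable m D θ Q).mulVec (windowState m θ x) ℓ -
      x * windowState m θ x ℓ‖ ^ 2 ≤ 2 := by
  have hδ0 : 0 ≤ δ := (abs_nonneg _).trans hx
  set b := 132 * windowScale m * D ^ 2 / θ with hb
  have hboundary : 2 ^ m * b ^ 2 ≤ 1 / 2 := by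
    have hsq : (2048 * (D : ℝ) ^ 2) ^ 2 ≤ (θ * 2 ^ m) ^ 2 := pow_le_pow_left₀ (by positivity) hθD 2
    calc 2 ^ m * b ^ 2 = 17424 * (D : ℝ) ^ 4 * 2 ^ m / θ ^ 2 * windowScale m ^ 2 := by
          rw [hb]
          ring
      _ ≤ 17424 * (D : ℝ) ^ 4 * 2 ^ m / θ ^ 2 * (32 / (2 ^ m : ℝ) ^ 3) := by
          gcongr
          exact windowScale_sq_le hm
      _ = 557568 * (D : ℝ) ^ 4 / (θ * 2 ^ m) ^ 2 := by field_simp; ring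
      _ ≤ 1 / 2 := by
          rw [div_le_iff₀ (by positivity)]
          nlinarith [pow_nonneg (Nat.cast_nonneg (α := ℝ) D) 4]
  calc _ ≤ ∑ ℓ : Fin (2 ^ m), (2 * b ^ 2 + 2 * δ ^ 2 * window m (ℓ : ℕ) ^ 2) := by
        refine Finset.sum_le_sum fun ℓ _ => ?_
        calc _ ≤ (b + δ * window m (ℓ : ℕ)) ^ 2 := pow_le_pow_left₀ (norm_nonneg _)
              (norm_pointerObservable_mulVec_sub_le hm hD hθ hQ hx ℓ) 2
          _ ≤ 2 * b ^ 2 + 2 * δ ^ 2 * window m (ℓ : ℕ) ^ 2 := by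
              nlinarith [sq_nonneg (b - δ * window m (ℓ : ℕ))]
    _ = 2 * (2 ^ m * b ^ 2) + 2 * δ ^ 2 := by
        rw [Finset.sum_add_distrib, ← Finset.mul_sum _ _ (2 * δ ^ 2), sum_window_sq hm,
          Finset.sum_const, Finset.card_univ, Fintype.card_fin, nsmul_eq_mul]
        push_cast
        ring
    _ ≤ 2 := by nlinarith

end PointerObservable

section Accuracy

variable {m : ℕ}

theorem sum_eigenvalues_mul_likelihood {A : Op (2 ^ m)} (hA : A.IsHermitian)
    (U : Matrix.unitaryGroup (Fin (2 ^ m)) ℂ) (θ x : ℝ) :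
    ((∑ j, hA.eigenvalues j * likelihood U hA.eigenvectorUnitary θ j x : ℝ) : ℂ) =
      star (pointerState (fun ℓ => U ℓ ⟨0, by positivity⟩) θ x) ⬝ᵥ
        A.mulVec (pointerState (fun ℓ => U ℓ ⟨0, by positivity⟩) θ x) := by
  rw [star_dotProduct_mulVec_eq_sum hA]
  rfl

theorem sum_sq_sub_mul_likelihood {A : Op (2 ^ m)} (hA : A.IsHermitian)
    (U : Matrix.unitaryGroup (Fin (2 ^ m)) ℂ) (θ x : ℝ) :
    ∑ j, (hA.eigenvalues j - x) ^ 2 * likelihood U hA.eigenvectorUnitary θ j x =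
      ∑ ℓ, ‖A.mulVec (pointerState (fun ℓ => U ℓ ⟨0, by positivity⟩) θ x) ℓ -
        x * pointerState (fun ℓ => U ℓ ⟨0, by positivity⟩) θ x ℓ‖ ^ 2 := by
  set ψ := pointerState (fun ℓ => U ℓ ⟨0, by positivity⟩) θ x
  calc _ = ∑ j, ‖(star (hA.eigenvectorUnitary : Op (2 ^ m))).mulVec
        (A.mulVec ψ - (x : ℂ) • ψ) j‖ ^ 2 := by
        refine Finset.sum_congr rfl fun j _ => ?_
        rw [Matrix.mulVec_sub, Matrix.mulVec_smul, Pi.sub_apply, Pi.smul_apply,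
          star_eigenvectorUnitary_mulVec_mulVec, smul_eq_mul, ← sub_mul, norm_mul, mul_pow,
          ← Complex.ofReal_sub, Complex.norm_real, Real.norm_eq_abs, sq_abs, likelihood, amplitude]
    _ = _ := sum_norm_sq_star_mulVec _ _

theorem abs_inv_mul_sum_sawtoothCoeff_sub_le {κ ε x : ℝ} (hκ : 0 < κ) (hε : 0 < ε) {D : ℕ}
    (hD1 : 1 ≤ D) (hD : 12 * κ / ε ≤ 4 ^ D) (hx : |x| ≤ κ) :
    |(1 / (2 * κ))⁻¹ * ∑ k ∈ Finset.range D,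
      sawtoothCoeff D k * (2 * Real.sin (k * (1 / (2 * κ) * x))) - x| ≤ ε / 2 := by
  have hangle : |1 / (2 * κ) * x| ≤ 1 / 2 := by
    rw [abs_mul, abs_of_pos (by positivity), one_div, inv_mul_eq_div, div_le_iff₀ (by positivity)]
    linarith
  have hscale : x = 2 * κ * (1 / (2 * κ) * x) := by field_simp
  rw [div_le_iff₀ hε] at hD
  nth_rw 2 [hscale]
  rw [one_div, inv_inv, ← mul_sub, abs_mul, abs_of_pos (by positivity), ← one_div]
  calc _ ≤ 2 * κ * (3 / 4 ^ D) := by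
        gcongr
        exact abs_sum_sawtoothCoeff_sub_le hD1 hangle
    _ ≤ ε / 2 := by
        rw [mul_div_assoc', div_le_iff₀ (by positivity)]
        linarith

theorem exists_isAccurate {κ ε : ℝ} (hκ : 2 ≤ κ) (hε : 0 < ε) (hε2 : ε ≤ 1 / 2) {D : ℕ}
    (hD1 : 1 ≤ D) (hD : 12 * κ / ε ≤ 4 ^ D) (hm : 4096 * κ * (D : ℝ) ^ 2 ≤ 2 ^ m) :
    ∃ (U W : Matrix.unitaryGroup (Fin (2 ^ m)) ℂ) (y : Fin (2 ^ m) → ℝ),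
      IsAccurate U W (1 / (2 * κ)) y κ ε := by
  have hκ0 : 0 < κ := by linarith
  have hD1r : (1 : ℝ) ≤ D := by exact_mod_cast hD1
  have hsize : 8192 * (D : ℝ) ^ 2 ≤ 2 ^ m := by nlinarith
  have hm2 : 2 ≤ m := by
    by_contra! hlt
    have : (2 : ℝ) ^ m ≤ 2 ^ 2 := pow_le_pow_right₀ (by norm_num) hlt.le
    nlinarith
  have hD64 : 64 * (D : ℝ) ≤ 2 ^ m := by nlinarith
  have hθD : 2048 * (D : ℝ) ^ 2 ≤ 1 / (2 * κ) * 2 ^ m := by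
    rw [one_div, inv_mul_eq_div, le_div_iff₀ (by positivity)]
    linarith
  have hoverlap (k : ℕ) (hk : k < D) : overlap m k ≠ 0 := by
    have hkD : (k : ℝ) ≤ D := by exact_mod_cast hk.le
    linarith [half_le_overlap hm2 (k := k) (by linarith)]
  set Q := sawtoothCoeff D
  have hA := pointerObservable_isHermitian m D (1 / (2 * κ)) Q
  obtain ⟨U, hU⟩ := exists_unitary_column (fun ℓ : Fin (2 ^ m) => ((window m (ℓ : ℕ) : ℝ) : ℂ))
    (by simpa only [Complex.norm_real, Real.norm_eq_abs, sq_abs] using sum_window_sq hm2)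
    ⟨0, by positivity⟩
  have hstate (x : ℝ) : pointerState (fun ℓ => U ℓ ⟨0, by positivity⟩) (1 / (2 * κ)) x =
      windowState m (1 / (2 * κ)) x := by
    rw [windowState, funext hU]
  refine ⟨U, hA.eigenvectorUnitary, hA.eigenvalues, fun x hx => ?_, fun x hx => ?_⟩
  · have hmean := sum_eigenvalues_mul_likelihood hA U (1 / (2 * κ)) x
    rw [hstate, star_dotProduct_pointerObservable_mulVec hoverlap] at hmean
    rw [Complex.ofReal_injective hmean]
    exact abs_inv_mul_sum_sawtoothCoeff_sub_le hκ0 hε hD1 hD hx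
  · rw [sum_sq_sub_mul_likelihood, hstate]
    exact sum_norm_sq_pointerObservable_sub_le hm2 hD64 (by positivity) hθD
      (sum_abs_sawtoothCoeff_le D) (by linarith)
      (abs_inv_mul_sum_sawtoothCoeff_sub_le hκ0 hε hD1 hD hx)

end Accuracy

/-! ### Choice of parameters -/

section Parameters

theorem log_two_le_log_inv {ε : ℝ} (hε : 0 < ε) (hε2 : ε ≤ 1 / 2) :
    Real.log 2 ≤ Real.log ε⁻¹ :=
  Real.log_le_log two_pos (by rw [le_inv_comm₀ two_pos hε]; linarith)

theorem exists_degree {κ ε : ℝ} (hκ : 2 ≤ κ) (hε : 0 < ε) (hε2 : ε ≤ 1 / 2) :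
    ∃ D : ℕ, 1 ≤ D ∧ 12 * κ / ε ≤ 4 ^ D ∧ (D : ℝ) ≤ 7 * (Real.log κ + Real.log ε⁻¹) := by
  have hκ0 : 0 < κ := by linarith
  have hratio : 1 < 12 * κ / ε := by rw [lt_div_iff₀ hε]; linarith
  have hratio0 : 0 < 12 * κ / ε := one_pos.trans hratio
  have hlog0 : 0 < Real.log (12 * κ / ε) := Real.log_pos hratio
  have hlog : Real.log (12 * κ / ε) ≤ 4 * Real.log 2 + Real.log κ + Real.log ε⁻¹ := by
    have hlog12 : Real.log 12 ≤ 4 * Real.log 2 := by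
      rw [← Real.log_rpow two_pos]
      exact Real.log_le_log (by norm_num) (by norm_num)
    rw [div_eq_mul_inv, Real.log_mul (by positivity) (by positivity),
      Real.log_mul (by norm_num) hκ0.ne']
    linarith
  refine ⟨⌈Real.log (12 * κ / ε)⌉₊, Nat.one_le_iff_ne_zero.2 (Nat.ceil_pos.2 hlog0).ne', ?_, ?_⟩
  · calc 12 * κ / ε = Real.exp (Real.log (12 * κ / ε)) := (Real.exp_log hratio0).symm
      _ ≤ Real.exp (⌈Real.log (12 * κ / ε)⌉₊ * 1) := by
          rw [mul_one]
          exact Real.exp_le_exp.2 (Nat.le_ceil _)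
      _ = Real.exp 1 ^ ⌈Real.log (12 * κ / ε)⌉₊ := Real.exp_nat_mul _ _
      _ ≤ 4 ^ _ := by
          gcongr
          linarith [Real.exp_one_lt_d9]
  · have hlogκ : Real.log 2 ≤ Real.log κ := Real.log_le_log two_pos hκ
    linarith [Nat.ceil_lt_add_one hlog0.le, Real.log_two_gt_d9, log_two_le_log_inv hε hε2]

theorem log_degree_le {κ ε : ℝ} (hκ : 2 ≤ κ) (hε : 0 < ε) (hε2 : ε ≤ 1 / 2) {D : ℕ} (hD1 : 1 ≤ D)
    (hD : (D : ℝ) ≤ 7 * (Real.log κ + Real.log ε⁻¹)) :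
    Real.log D ≤ 4 * Real.log 2 + Real.log κ + Real.log (Real.log ε⁻¹) := by
  have hκ0 : 0 < κ := by linarith
  have hlogε : 0.69 < Real.log ε⁻¹ := by
    linarith [Real.log_two_gt_d9, log_two_le_log_inv hε hε2]
  have hlogε0 : 0 < Real.log ε⁻¹ := by linarith
  have hlogκ : Real.log κ ≤ κ - 1 := Real.log_le_sub_one_of_pos hκ0
  calc Real.log D ≤ Real.log (2 ^ 4 * κ * Real.log ε⁻¹) := by
        refine Real.log_le_log (by exact_mod_cast hD1) (hD.trans ?_)
        nlinarith
    _ = _ := by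
        rw [Real.log_mul (by positivity) hlogε0.ne', Real.log_mul (by positivity) hκ0.ne',
          Real.log_pow, Nat.cast_ofNat]

theorem ancillas_le {κ ε : ℝ} (hκ : 2 ≤ κ) (hε : 0 < ε) (hε2 : ε ≤ 1 / 2) {D m : ℕ} (hD1 : 1 ≤ D)
    (hD : (D : ℝ) ≤ 7 * (Real.log κ + Real.log ε⁻¹)) (hm : 2 ^ m ≤ 8192 * κ * (D : ℝ) ^ 2) :
    (m : ℝ) ≤ 200 * (Real.log κ + Real.log (Real.log ε⁻¹)) := by
  have hlogκ : Real.log 2 ≤ Real.log κ := Real.log_le_log two_pos hκ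
  have hlogε := log_two_le_log_inv hε hε2
  have hlog2 := Real.log_two_gt_d9
  have hloglog : -0.45 ≤ Real.log (Real.log ε⁻¹) := by
    have hinv : (Real.log ε⁻¹)⁻¹ ≤ 1.45 := by
      rw [inv_le_comm₀ (by linarith) (by norm_num)]
      exact le_trans (by norm_num) (hlog2.le.trans hlogε)
    linarith [Real.one_sub_inv_le_log_of_pos (by linarith : 0 < Real.log ε⁻¹)]
  have hlogm : m * Real.log 2 ≤ 13 * Real.log 2 + Real.log κ + 2 * Real.log D := by
    have hD0 : (D : ℝ) ≠ 0 := by exact_mod_cast Nat.one_le_iff_ne_zero.1 hD1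
    calc m * Real.log 2 = Real.log (2 ^ m) := (Real.log_pow _ _).symm
      _ ≤ Real.log (2 ^ 13 * κ * (D : ℝ) ^ 2) :=
          Real.log_le_log (by positivity) (hm.trans_eq (by norm_num))
      _ = _ := by
          rw [Real.log_mul (by positivity) (by positivity),
            Real.log_mul (by positivity) (by positivity), Real.log_pow, Real.log_pow]
          norm_num
  have hm0 : (m : ℝ) * 0.69 ≤ m * Real.log 2 := by gcongr; linarith
  linarith [log_degree_le hκ hε hε2 hD1 hD, Real.log_two_lt_d9]

theorem exists_pointer {κ ε : ℝ} (hκ : 2 ≤ κ) (hε : 0 < ε) (hε2 : ε ≤ 1 / 2) :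
    ∃ (m : ℕ) (U W : Matrix.unitaryGroup (Fin (2 ^ m)) ℂ) (θ : ℝ) (y : Fin (2 ^ m) → ℝ),
      IsAccurate U W θ y κ ε ∧ (m : ℝ) ≤ 200 * (Real.log κ + Real.log (Real.log ε⁻¹)) ∧
      (pointer U W θ y).time ≤ 200704 * (Real.log ε⁻¹ ^ 2 + Real.log κ ^ 2) := by
  obtain ⟨D, hD1, hD4, hD⟩ := exists_degree hκ hε hε2
  have hsize : 1 ≤ 4096 * κ * (D : ℝ) ^ 2 := by
    have : (1 : ℝ) ≤ (D : ℝ) ^ 2 := one_le_pow₀ (by exact_mod_cast hD1)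
    nlinarith
  obtain ⟨n, hn, hn'⟩ := exists_nat_pow_near hsize one_lt_two
  obtain ⟨U, W, y, hacc⟩ := exists_isAccurate hκ hε hε2 hD1 hD4 hn'.le
  have hm : (2 : ℝ) ^ (n + 1) ≤ 8192 * κ * (D : ℝ) ^ 2 := by rw [pow_succ]; linarith
  refine ⟨n + 1, U, W, 1 / (2 * κ), y, hacc, ancillas_le hκ hε hε2 hD1 hD hm, ?_⟩
  rw [pointer_time, abs_of_pos (by positivity)]
  calc 1 / (2 * κ) * (2 ^ (n + 1) / 2) ≤ 1 / (2 * κ) * (8192 * κ * (D : ℝ) ^ 2 / 2) := by gcongr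
    _ = 2048 * (D : ℝ) ^ 2 := by field_simp; ring
    _ ≤ 2048 * (7 * (Real.log κ + Real.log ε⁻¹)) ^ 2 := by gcongr
    _ ≤ 200704 * (Real.log ε⁻¹ ^ 2 + Real.log κ ^ 2) := by
        nlinarith [sq_nonneg (Real.log κ - Real.log ε⁻¹)]

end Parameters

/-! ### Estimation -/

/-- The analogue of `Estimates` in which the Gibbs state of a qubit Hamiltonian is replaced by an
arbitrary faithful state on a space of arbitrary finite dimension, and the parameter `s` of the
detailed balance condition is an arbitrary real number. -/
def EstimatesFaithful (P : Protocol) (κ ε η V Δ : ℝ) (T : ℕ) : Prop :=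
  ∀ (d : ℕ) (ρ O : Op d) (s : ℝ) (N : SuperOp d),
    ρ.PosDef → ρ.trace = 1 → O.IsHermitian → Commute ρ O → opNorm O ≤ κ →
    IsGibbsSampler ρ s N → variance ρ O ≤ V → Δ ≤ gap N → mixingTime ρ N η ≤ T →
    ∀ σ : Op d, IsState σ → 1 - 2 * η ≤ P.successProb O N σ (expect ρ O) ε

section Estimation

variable {P : Protocol} {κ ε η V Δ : ℝ} {T : ℕ}

theorem EstimatesFaithful.estimates (h : EstimatesFaithful P κ ε η V Δ T) :
    Estimates P κ ε η V Δ T :=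
  fun n _ O β s N hH hO hOH hκ _ _ hN hV hgap hT =>
    h (2 ^ n) _ O s N (gibbs_posDef hH β) (gibbs_trace hH β) hO (gibbs_commute hOH β) hκ hN hV
      hgap hT

theorem estimatesFaithful_of_half_le (hη : 1 / 2 ≤ η) : EstimatesFaithful P κ ε η V Δ T :=
  fun _ _ _ _ _ _ _ _ _ _ hN _ _ _ _ hσ =>
    le_trans (by linarith) (P.successProb_nonneg hN.channel hσ.1 _ _)

theorem estimatesFaithful_of_one_lt (hΔ : 1 < Δ) : EstimatesFaithful P κ ε η V Δ T :=
  fun _ _ _ _ _ _ _ _ _ _ hN _ hgap => absurd (hgap.trans hN.gap_le_one) hΔ.not_ge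

theorem half_le_floor {x : ℝ} (hx : 1 ≤ x) : x / 2 ≤ ⌊x⌋₊ := by
  have hfloor : (1 : ℝ) ≤ ⌊x⌋₊ := by exact_mod_cast (Nat.one_le_floor_iff x).2 hx
  linarith [Nat.lt_floor_add_one x]

theorem one_sub_pow_ceil_le_half (hΔ : 0 < Δ) (hΔ1 : Δ ≤ 1) : (1 - Δ) ^ ⌈1 / Δ⌉₊ ≤ 1 / 2 :=
  calc (1 - Δ) ^ ⌈1 / Δ⌉₊ ≤ Real.exp (-Δ) ^ ⌈1 / Δ⌉₊ :=
        pow_le_pow_left₀ (by linarith) (Real.one_sub_le_exp_neg Δ) _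
    _ = Real.exp (⌈1 / Δ⌉₊ * -Δ) := (Real.exp_nat_mul _ _).symm
    _ ≤ Real.exp (-1) := by
        have hceil := Nat.le_ceil (1 / Δ)
        rw [div_le_iff₀ hΔ] at hceil
        exact Real.exp_le_exp.2 (by linarith)
    _ ≤ 1 / 2 := by
        rw [Real.exp_neg, one_div]
        exact inv_anti₀ two_pos (by linarith [Real.add_one_le_exp 1])

theorem one_le_variance_div (hV : 0 ≤ V) (hε : 0 < ε) (hε2 : ε ≤ 1 / 2) (hη : 0 < η)
    (hη2 : η < 1 / 2) : 1 ≤ (V + 1) / (ε ^ 2 * η) := by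
  rw [one_le_div (by positivity)]
  have hε1 : ε ^ 2 ≤ 1 := pow_le_one₀ hε.le (by linarith)
  nlinarith

namespace IsAccurate

variable {m : ℕ} {U W : Matrix.unitaryGroup (Fin (2 ^ m)) ℂ} {θ : ℝ} {y : Fin (2 ^ m) → ℝ}

/- Chebyshev's inequality: `1 + 2 q / (1 - q)` bounds the sum of the autocorrelations of the
recorded outcomes, whose variance is at most `5 (V + 1)`. -/
theorem estimatesFaithful (h : IsAccurate U W θ y κ ε) (hε : 0 < ε) (hε1 : ε ≤ 1) (hη : 0 < η)
    (hΔ : 0 < Δ) {K r : ℕ} {q : ℝ} (hq : (1 - Δ) ^ r ≤ q) (hq1 : q < 1) (hK : 0 < K)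
    (hrounds : 20 * ((V + 1) / (ε ^ 2 * η)) * (1 + 2 * (q / (1 - q))) ≤ K) :
    EstimatesFaithful ⟨pointer U W θ y, T, K, r⟩ κ ε η V Δ T := by
  intro d ρ O s N hρ hρ1 hO hρO hκ hN hV hgap hT σ hσ
  have hbias := h.abs_expect_effect_sub_le hO hρ.posSemidef hρ1 hκ
  have hvar := h.expect_effect_sub_sq_le hO hρ.posSemidef hρ1 hκ (hbias.trans (by linarith))
  have hgapq : (1 - gap N) ^ r ≤ q :=
    (pow_le_pow_left₀ (sub_nonneg.2 hN.gap_le_one) (by linarith) r).trans hq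
  have hcheb : 5 * (V + 1) * (1 + 2 * (q / (1 - q))) ≤ η * (K * (ε / 2) ^ 2) :=
    calc _ = η * (20 * ((V + 1) / (ε ^ 2 * η)) * (1 + 2 * (q / (1 - q))) * (ε / 2) ^ 2) := by
          field_simp
          ring
      _ ≤ η * (K * (ε / 2) ^ 2) := by gcongr
  refine Protocol.one_sub_le_successProb ⟨pointer U W θ y, T, K, r⟩ ?_ hN hρ hρ1
    (hΔ.trans_le hgap) hη hT hgapq hq1 hε ?_ hbias ?_ hK hcheb hσ
  · rw [pointer_kraus]
    exact isCommutingInstrument_pointerKraus U W θ hO hρO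
  · rw [pointer_kraus]
    rfl
  · rw [pointer_kraus]
    exact hvar.trans (by linarith)

theorem estimatesFaithful_every_step (h : IsAccurate U W θ y κ ε) (hε : 0 < ε) (hε2 : ε ≤ 1 / 2)
    (hη : 0 < η) (hV : 0 ≤ V) (hΔ : 0 < Δ) :
    EstimatesFaithful ⟨pointer U W θ y, T, ⌊80 * ((V + 1) / (ε ^ 2 * η) / Δ)⌋₊, 1⟩ κ ε η V Δ T := by
  rcases le_or_gt (1 / 2) η with hη2 | hη2
  · exact estimatesFaithful_of_half_le hη2
  rcases lt_or_ge 1 Δ with hΔ1 | hΔ1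
  · exact estimatesFaithful_of_one_lt hΔ1
  have hc := one_le_variance_div hV hε hε2 hη hη2
  set c := (V + 1) / (ε ^ 2 * η) with hcdef
  have hcΔ : 1 ≤ c / Δ := by rw [one_le_div hΔ]; linarith
  have hfloor := half_le_floor (by linarith : 1 ≤ 80 * (c / Δ))
  refine h.estimatesFaithful (q := 1 - Δ) hε (by linarith) hη hΔ (pow_one _).le (by linarith)
    (Nat.floor_pos.2 (by linarith)) ?_
  rw [← hcdef]
  calc 20 * c * (1 + 2 * ((1 - Δ) / (1 - (1 - Δ)))) = 40 * (c / Δ) - 20 * c := by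
        rw [sub_sub_cancel]
        field_simp
        ring
    _ ≤ ⌊80 * (c / Δ)⌋₊ := by linarith

theorem estimatesFaithful_skipping (h : IsAccurate U W θ y κ ε) (hε : 0 < ε) (hε2 : ε ≤ 1 / 2)
    (hη : 0 < η) (hV : 0 ≤ V) (hΔ : 0 < Δ) :
    EstimatesFaithful ⟨pointer U W θ y, T,
      ⌊120 * ((V + 1) / (ε ^ 2 * η)) * min 1 (1 / Δ)⌋₊, ⌈1 / Δ⌉₊⟩ κ ε η V Δ T := by
  rcases le_or_gt (1 / 2) η with hη2 | hη2
  · exact estimatesFaithful_of_half_le hη2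
  rcases lt_or_ge 1 Δ with hΔ1 | hΔ1
  · exact estimatesFaithful_of_one_lt hΔ1
  have hc := one_le_variance_div hV hε hε2 hη hη2
  rw [min_eq_left ((one_le_div hΔ).2 hΔ1), mul_one]
  have hfloor := half_le_floor (by linarith : 1 ≤ 120 * ((V + 1) / (ε ^ 2 * η)))
  refine h.estimatesFaithful hε (by linarith) hη hΔ (one_sub_pow_ceil_le_half hΔ hΔ1) (by norm_num)
    (Nat.floor_pos.2 (by linarith)) ?_
  norm_num
  linarith

end IsAccurate

theorem floor_mul_ceil_le {c x : ℝ} (hc : 0 ≤ c) (hx : 0 ≤ x) :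
    (⌊c * min 1 x⌋₊ : ℝ) * ⌈x⌉₊ ≤ 2 * (c * x) :=
  calc (⌊c * min 1 x⌋₊ : ℝ) * ⌈x⌉₊ ≤ c * min 1 x * (2 * max 1 x) := by
        gcongr
        · exact Nat.floor_le (by positivity)
        · linarith [Nat.ceil_lt_add_one hx, le_max_left 1 x, le_max_right 1 x]
    _ = 2 * (c * (min 1 x * max 1 x)) := by ring
    _ = 2 * (c * x) := by rw [min_mul_max, one_mul]

theorem samplerTime_le {b : ℝ} (hP : (P.rounds * P.spacing : ℝ) ≤ 240 * b) :
    (P.samplerTime : ℝ) ≤ P.burnIn + 10 ^ 8 * b := by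
  have hb : 0 ≤ (P.rounds * P.spacing : ℝ) := by positivity
  rw [Protocol.samplerTime]
  push_cast
  linarith

theorem evolutionTime_le {S b : ℝ} (hS : 0 ≤ S) (hP : P.meas.time ≤ 200704 * S)
    (hrounds : (P.rounds : ℝ) ≤ 120 * b) : P.evolutionTime ≤ 10 ^ 8 * b * S := by
  have hb : 0 ≤ b := by linarith [Nat.cast_nonneg (α := ℝ) P.rounds]
  calc 2 * P.rounds * P.meas.time ≤ 2 * P.rounds * (200704 * S) := by gcongr
    _ ≤ 2 * (120 * b) * (200704 * S) := by gcongr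
    _ ≤ 10 ^ 8 * b * S := by linarith [mul_nonneg hb hS]

end Estimation

end ThermalEst

end

theorem corollary6p4_general :
    ∃ C : ℝ, 0 < C ∧
      ∀ (κ ε η V Δ : ℝ) (T : ℕ),
        2 ≤ κ → 0 < ε → ε ≤ 1 / 2 → 0 < η → 0 ≤ V → 0 < Δ →
        ∃ P P' : ThermalEst.Protocol,
          P.spacing = 1 ∧
          (P.ancillas : ℝ) ≤ C * (Real.log κ + Real.log (Real.log ε⁻¹)) ∧
          (P.samplerTime : ℝ) ≤ T + C * ((V + 1) / (ε ^ 2 * η * Δ)) ∧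
          P.evolutionTime ≤
            C * ((V + 1) / (ε ^ 2 * η * Δ)) * (Real.log ε⁻¹ ^ 2 + Real.log κ ^ 2) ∧
          ThermalEst.EstimatesFaithful P κ ε η V Δ T ∧
          P'.meas = P.meas ∧
          P'.spacing = ⌈1 / Δ⌉₊ ∧
          (P'.samplerTime : ℝ) ≤ T + C * ((V + 1) / (ε ^ 2 * η * Δ)) ∧
          P'.evolutionTime ≤
            C * ((V + 1) / (ε ^ 2 * η)) * (Real.log ε⁻¹ ^ 2 + Real.log κ ^ 2) ∧
          ThermalEst.EstimatesFaithful P' κ ε η V Δ T := by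
  refine ⟨10 ^ 8, by norm_num, fun κ ε η V Δ T hκ hε hε2 hη hV hΔ => ?_⟩
  obtain ⟨m, U, W, θ, y, hacc, hm, htime⟩ := ThermalEst.exists_pointer hκ hε hε2
  have hS : 0 ≤ Real.log ε⁻¹ ^ 2 + Real.log κ ^ 2 := by positivity
  have hm0 : (0 : ℝ) ≤ m := Nat.cast_nonneg m
  have hΔ' : 0 ≤ 1 / Δ := by positivity
  set c := (V + 1) / (ε ^ 2 * η)
  have hc : 0 ≤ c := by positivity
  have hrounds : (⌊80 * (c / Δ)⌋₊ : ℝ) ≤ 80 * (c / Δ) := Nat.floor_le (by positivity)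
  have hrounds' : (⌊120 * c * min 1 (1 / Δ)⌋₊ : ℝ) ≤ 120 * c :=
    (Nat.floor_le (by positivity)).trans (mul_le_of_le_one_right (by positivity) (min_le_left _ _))
  have hskip := ThermalEst.floor_mul_ceil_le (c := 120 * c) (by positivity) hΔ'
  have hcΔ : 0 ≤ c / Δ := by positivity
  rw [← div_div]
  refine ⟨⟨ThermalEst.pointer U W θ y, T, ⌊80 * (c / Δ)⌋₊, 1⟩,
    ⟨ThermalEst.pointer U W θ y, T, ⌊120 * c * min 1 (1 / Δ)⌋₊, ⌈1 / Δ⌉₊⟩,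
    rfl, le_trans hm (by linarith), ThermalEst.samplerTime_le (by push_cast; linarith),
    ThermalEst.evolutionTime_le hS htime (by linarith),
    hacc.estimatesFaithful_every_step hε hε2 hη hV hΔ, rfl, rfl,
    ThermalEst.samplerTime_le (hskip.trans_eq (by ring)),
    ThermalEst.evolutionTime_le hS htime hrounds',
    hacc.estimatesFaithful_skipping hε hε2 hη hV hΔ⟩

theorem corollary6p4 :
    ∃ (C : ℝ) (a : ℕ), 0 < C ∧
      ∀ (κ ε η V Δ : ℝ) (T : ℕ),
        2 ≤ κ → 0 < ε → ε ≤ 1 / 2 → 0 < η → 0 ≤ V → 0 < Δ →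
        ∃ P P' : ThermalEst.Protocol,
          -- measuring after every application of the sampler
          P.spacing = 1 ∧
          (P.ancillas : ℝ) ≤ C * (Real.log κ + Real.log (Real.log ε⁻¹)) ∧
          (P.samplerTime : ℝ) ≤ T + C * ((V + 1) / (ε ^ 2 * η * Δ)) ∧
          P.evolutionTime ≤
            C * ((V + 1) / (ε ^ 2 * η * Δ)) * (Real.log ε⁻¹ ^ a + Real.log κ ^ a) ∧
          ThermalEst.Estimates P κ ε η V Δ T ∧
          -- the same measurement, performed only once every `⌈1 / Δ⌉` applications
          P'.meas = P.meas ∧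
          P'.spacing = ⌈1 / Δ⌉₊ ∧
          (P'.samplerTime : ℝ) ≤ T + C * ((V + 1) / (ε ^ 2 * η * Δ)) ∧
          P'.evolutionTime ≤
            C * ((V + 1) / (ε ^ 2 * η)) * (Real.log ε⁻¹ ^ a + Real.log κ ^ a) ∧
          ThermalEst.Estimates P' κ ε η V Δ T := by
  obtain ⟨C, hC, h⟩ := corollary6p4_general
  refine ⟨C, 2, hC, fun κ ε η V Δ T hκ hε hε2 hη hV hΔ => ?_⟩
  obtain ⟨P, P', hr, hm, hN, hM, hP, hmeas, hr', hN', hM', hP'⟩ := h κ ε η V Δ T hκ hε hε2 hη hV hΔ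
  exact ⟨P, P', hr, hm, hN, hM, hP.estimates, hmeas, hr', hN', hM', hP'.estimates⟩
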